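/- Let $J$ be one of $\mathbb Z$, $\mathbb Z_+=\{n\in\mathbb Z: n\ge 0\}$, $\mathbb Z_-=\{n\in\mathbb Z: n\le 0\}$, and let $\mathbf a=(a_n)_{n\in J}\subset(0,\infty)$ satisfy $a_{n+1}\ge 2a_n$ whenever $n,n+1\in J$. For $t>0$ let $n_0=n_0(t)$ be the index $n$ with $n,n+1\in J$ and $a_n<t\le a_{n+1}$, if there is one; otherwise put $n_0(t)=0$ if $J=\mathbb Z_-$ and $t>a_0$, and $n_0(t)=-1$, with $a_{-1}:=0$, if $J=\mathbb Z_+$ and $t\le a_0$. Let $I_n(t)=(a_n-t,a_n]$ for $n\in J$ with $n>n_0(t)$, and $I_{n_0}(t)=[0,2a_{n_0}-t]$ (empty if $2a_{n_0}<t$). These sets are pairwise disjoint, and $V_{\mathbf a}(t)$ is the bounded operator on the complex Hilbert space $L^2(\mathbb R_+)$, $\mathbb R_+=[0,\infty)$, given by $$(V_{\mathbf a}(t)f)(x)=\begin{cases} f(2a_n-x-t), & x\in I_n(t),\ n\ge n_0(t),\\ 0, & \text{otherwise;}\end{cases}$$ put $V_{\mathbf a}(0)=0$. Let $(L(t))_{t\ge0}$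 and $(R(t))_{t\ge0}$ be the left and right shift semigroups on $L^2(\mathbb R_+)$, i.e. $(L(t)f)(x)=f(x+t)$, and $(R(t)f)(x)=f(x-t)$ for $x\ge t$, $(R(t)f)(x)=0$ for $x<t$. On the orthogonal direct sum $H=L^2(\mathbb R_+)\oplus L^2(\mathbb R_+)$ set $$T_{\mathbf a}(t)=\begin{pmatrix} L(t) & V_{\mathbf a}(t)\\ 0 & R(t)\end{pmatrix},\qquad t\ge 0 .$$ A bounded operator $T$ on $H$ is similar to a contraction if $\|RTR^{-1}\|\le 1$ for some invertible bounded operator $R$ on $H$. A $C_0$-semigroup $(T(t))_{t\ge0}$ on $H$ belongs to $\mathcal{SQC}(H)$ if it is similar to a quasi-contraction semigroup, i.e. if there are an invertible bounded operator $R$ on $H$ and $\lambda\in\mathbb R$ such that $\|RT(t)R^{-1}\|\le e^{\lambda t}$ for all $t\ge0$. Then $\mathcal T_{\mathbf a}=(T_{\mathbf a}(t))_{t\ge0}$ is a $C_0$-semigroup on $H$, and: (i) for every $t>0$, the operator $T_{\mathbf a}(t)$ is similar to a contraction if and only if $J=\mathbb Z_-$; (ii) $\mathcal T_{\mathbf a}\in\mathcal{SQC}(H)$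 if and only if $J=\mathbb Z_+$. -/

import Mathlib

open MeasureTheory Set Filter Topology

noncomputable section

namespace PackelSemigroup

/-! ### Similarity to contractions and to quasi-contraction semigroups -/

section Similarity

variable {H : Type*} [NormedAddCommGroup H] [InnerProductSpace ℂ H]

/-- The conjugate `R T R⁻¹` of a bounded operator by an invertible bounded operator. -/
def conjBy (R : H ≃L[ℂ] H) (T : H →L[ℂ] H) : H →L[ℂ] H :=
  (R : H →L[ℂ] H) ∘L T ∘L (R.symm : H →L[ℂ] H)

/-- `T` is similar to a contraction: `‖R T R⁻¹‖ ≤ 1` for some invertible bounded `R`. -/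
def IsSimilarToContraction (T : H →L[ℂ] H) : Prop :=
  ∃ R : H ≃L[ℂ] H, ‖conjBy R T‖ ≤ 1

/-- `(T t)_{t ≥ 0}` is a `C₀`-semigroup; values of `T` at negative times play no role. -/
structure IsC0Semigroup (T : ℝ → H →L[ℂ] H) : Prop where
  map_zero : T 0 = ContinuousLinearMap.id ℂ H
  map_add : ∀ s t : ℝ, 0 ≤ s → 0 ≤ t → T (s + t) = T s ∘L T t
  tendsto_zero : ∀ h : H, Tendsto (fun t => T t h) (𝓝[>] 0) (𝓝 h)

/-- `(S t)_{t ≥ 0}` is a quasi-contraction semigroup. -/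
def IsQuasiContraction (S : ℝ → H →L[ℂ] H) : Prop :=
  IsC0Semigroup S ∧ ∃ lam : ℝ, ∀ t : ℝ, 0 ≤ t → ‖S t‖ ≤ Real.exp (lam * t)

/-- The class `SQC(H)`: the `C₀`-semigroups on `H` that are similar, through one invertible
operator for all times, to a quasi-contraction semigroup. -/
def IsSQC (T : ℝ → H →L[ℂ] H) : Prop :=
  IsC0Semigroup T ∧
    ∃ R : H ≃L[ℂ] H, IsQuasiContraction (fun t => conjBy R (T t))

end Similarity

/-! ### Partial composition operators on `L²(ℝ₊)` -/

/-- Lebesgue measure on `ℝ₊ = [0, ∞)`. -/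
abbrev halfLine : Measure ℝ := volume.restrict (Ici (0 : ℝ))

/-- The complex Hilbert space `L²(ℝ₊)`. -/
abbrev L2 : Type := Lp ℂ 2 halfLine

/-- If `φ` maps `S` into `ℝ₊` without increasing Lebesgue measure, then `f ∘ φ` on `S`, extended
by zero, is in `L²(ℝ₊)` for each `f ∈ L²(ℝ₊)`. -/
theorem memLp_partialComp (φ : ℝ → ℝ) (S : Set ℝ) (hφ : Measurable φ) (hS : MeasurableSet S)
    (hle : (halfLine.restrict S).map φ ≤ halfLine) (f : L2) :
    MemLp (S.indicator (fun x => f (φ x))) 2 halfLine := by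
  rw [memLp_indicator_iff_restrict hS]
  exact ((Lp.memLp f).mono_measure hle).comp_of_map hφ.aemeasurable

theorem ae_partialComp (φ : ℝ → ℝ) (S : Set ℝ) (hφ : Measurable φ) (hS : MeasurableSet S)
    (hle : (halfLine.restrict S).map φ ≤ halfLine) {p : ℝ → Prop}
    (hp : ∀ᵐ y ∂halfLine, p y) : ∀ᵐ x ∂halfLine, x ∈ S → p (φ x) := by
  rw [← ae_restrict_iff' hS]
  exact ae_of_ae_map hφ.aemeasurable (hle.absolutelyContinuous.ae_le hp)

/-- The operator on `L²(ℝ₊)` sending `f` to the function equal to `f (φ x)` for `x ∈ S` and to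
`0` for the other `x`. -/
def partialComp (φ : ℝ → ℝ) (S : Set ℝ) (hφ : Measurable φ) (hS : MeasurableSet S)
    (hle : (halfLine.restrict S).map φ ≤ halfLine) : L2 →L[ℂ] L2 :=
  LinearMap.mkContinuous
    { toFun := fun f => (memLp_partialComp φ S hφ hS hle f).toLp _
      map_add' := by
        intro f g
        rw [← MemLp.toLp_add]
        refine MemLp.toLp_congr _ _ ?_
        filter_upwards [ae_partialComp φ S hφ hS hle (Lp.coeFn_add f g)] with x hx
        by_cases h : x ∈ S
        · rw [Pi.add_apply, indicator_of_mem h, indicator_of_mem h, indicator_of_mem h]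
          exact hx h
        · simp [h]
      map_smul' := by
        intro c f
        rw [RingHom.id_apply, ← MemLp.toLp_const_smul]
        refine MemLp.toLp_congr _ _ ?_
        filter_upwards [ae_partialComp φ S hφ hS hle (Lp.coeFn_smul c f)] with x hx
        by_cases h : x ∈ S
        · simp [h, hx h]
        · simp [h] }
    1 (by
      intro f
      simp only [LinearMap.coe_mk, AddHom.coe_mk, one_mul]
      rw [Lp.norm_toLp, Lp.norm_def]
      refine ENNReal.toReal_mono (Lp.memLp f).eLpNorm_ne_top ?_
      rw [eLpNorm_indicator_eq_eLpNorm_restrict hS]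
      have h1 := eLpNorm_map_measure (p := 2)
        ((Lp.memLp f).mono_measure hle).aestronglyMeasurable hφ.aemeasurable
      calc eLpNorm (fun x => f (φ x)) 2 (halfLine.restrict S)
          = eLpNorm f 2 ((halfLine.restrict S).map φ) := h1.symm
        _ ≤ eLpNorm f 2 halfLine := eLpNorm_mono_measure _ hle)

theorem coeFn_partialComp (φ : ℝ → ℝ) (S : Set ℝ) (hφ : Measurable φ) (hS : MeasurableSet S)
    (hle : (halfLine.restrict S).map φ ≤ halfLine) (f : L2) :
    partialComp φ S hφ hS hle f =ᵐ[halfLine] S.indicator (fun x => f (φ x)) :=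
  MemLp.coeFn_toLp (memLp_partialComp φ S hφ hS hle f)

/-! ### Shift semigroups on `L²(ℝ₊)` -/

theorem map_shift_le (s : ℝ) :
    (halfLine.restrict {x : ℝ | 0 ≤ x + s}).map (fun x => x + s) ≤ halfLine := by
  have hS : MeasurableSet {x : ℝ | 0 ≤ x + s} :=
    measurableSet_le measurable_const (measurable_id.add_const s)
  have hm : Measurable (fun x : ℝ => x + s) := measurable_id.add_const s
  refine Measure.le_iff.2 fun B hB => ?_
  rw [Measure.map_apply hm hB, Measure.restrict_apply (hm hB), Measure.restrict_apply hB]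
  calc halfLine ((fun x => x + s) ⁻¹' B ∩ {x : ℝ | 0 ≤ x + s})
      ≤ volume ((fun x => x + s) ⁻¹' B ∩ {x : ℝ | 0 ≤ x + s}) :=
        Measure.restrict_apply_le _ _
    _ = volume ((fun x => x + s) ⁻¹' (B ∩ Ici 0)) := rfl
    _ = volume (B ∩ Ici 0) := measure_preimage_add_right volume s _

/-- The shift `(shift s f)(x) = f (x + s)` where `x + s ∈ ℝ₊`, and `0` elsewhere. -/
def shift (s : ℝ) : L2 →L[ℂ] L2 :=
  partialComp (fun x => x + s) {x | 0 ≤ x + s} (measurable_id.add_const s)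
    (measurableSet_le measurable_const (measurable_id.add_const s)) (map_shift_le s)

/-- The left shift semigroup, `(L(t) f)(x) = f (x + t)`. -/
def leftShift (t : ℝ) : L2 →L[ℂ] L2 := shift t

/-- The right shift semigroup, `(R(t) f)(x) = f (x - t)` for `x ≥ t` and `0` for `x < t`. -/
def rightShift (t : ℝ) : L2 →L[ℂ] L2 := shift (-t)

/-! ### The operators `V_a(t)` -/

/-- `(a_n)_{n ∈ J}` is a sequence of positive numbers, indexed by `J = ℤ`, `ℤ₊` or `ℤ₋`, with
`a_{n+1} ≥ 2 a_n` whenever `n` and `n + 1` are in `J`. Values `a n` with `n ∉ J` play no role. -/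
structure IsLacunarySeq (J : Set ℤ) (a : ℤ → ℝ) : Prop where
  index : J = univ ∨ J = Ici 0 ∨ J = Iic 0
  pos : ∀ n ∈ J, 0 < a n
  two_mul_le : ∀ n, n ∈ J → n + 1 ∈ J → 2 * a n ≤ a (n + 1)

open Classical in
/-- The index `n₀(t)`: the `n` with `n, n + 1 ∈ J` and `a_n < t ≤ a_{n+1}` if there is one;
otherwise `0` if `t > a_0` (this occurs for `J = ℤ₋`), and `-1` if `t ≤ a_0`
(this occurs for `J = ℤ₊`). -/
def n₀ (J : Set ℤ) (a : ℤ → ℝ) (t : ℝ) : ℤ :=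
  if h : ∃ n : ℤ, n ∈ J ∧ n + 1 ∈ J ∧ a n < t ∧ t ≤ a (n + 1) then h.choose
  else if a 0 < t then 0 else -1

open Classical in
/-- The sets `I_n(t)`: `(a_n - t, a_n]` for `n ∈ J`, `n > n₀(t)`, and `[0, 2 a_{n₀} - t]` for
`n = n₀(t)`, where `a_{-1} = 0` if `n₀(t) = -1 ∉ J`. For all other `n` the set is empty. -/
def I (J : Set ℤ) (a : ℤ → ℝ) (t : ℝ) (n : ℤ) : Set ℝ :=
  if n = n₀ J a t then Icc 0 (2 * (if n ∈ J then a n else 0) - t)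
  else if n ∈ J ∧ n₀ J a t < n then Ioc (a n - t) (a n)
  else ∅

section Intervals

variable {J : Set ℤ} {a : ℤ → ℝ}

theorem IsLacunarySeq.two_mul_le_of_lt (ha : IsLacunarySeq J a) {m n : ℤ} (hm : m ∈ J)
    (hn : n ∈ J) (hmn : m < n) : 2 * a m ≤ a n := by
  have key : ∀ k : ℕ, m + 1 + k ∈ J → 2 * a m ≤ a (m + 1 + k) := by
    intro k
    induction k with
    | zero =>
      intro h
      simp only [Nat.cast_zero, add_zero] at h ⊢
      exact ha.two_mul_le m hm h
    | succ k ih =>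
      intro h
      have h1 : m + 1 + k ∈ J := by
        rcases ha.index with rfl | rfl | rfl
        · trivial
        · simp only [mem_Ici] at hm ⊢; omega
        · simp only [mem_Iic] at h ⊢; push_cast at h; omega
      have h2 := ha.two_mul_le _ h1 (by push_cast at h; rw [add_assoc]; exact h)
      have h3 := ha.pos _ h1
      have h4 := ih h1
      push_cast
      rw [← add_assoc]
      linarith
  obtain ⟨k, hk⟩ := Int.le.dest (show m + 1 ≤ n by omega)
  rw [← hk]
  exact key k (by rw [hk]; exact hn)

theorem IsLacunarySeq.lt_of_lt (ha : IsLacunarySeq J a) {m n : ℤ} (hm : m ∈ J)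
    (hn : n ∈ J) (hmn : m < n) : a m < a n := by
  have := ha.two_mul_le_of_lt hm hn hmn
  have := ha.pos m hm
  linarith

theorem IsLacunarySeq.exists_gt (ha : IsLacunarySeq J a) (h : ∀ n : ℤ, 0 ≤ n → n ∈ J) (t : ℝ) :
    ∃ n : ℤ, 0 ≤ n ∧ t < a n := by
  have key : ∀ k : ℕ, 2 ^ k * a 0 ≤ a k := by
    intro k
    induction k with
    | zero => simp
    | succ k ih =>
      have := ha.two_mul_le k (h _ (by omega)) (h _ (by omega))
      push_cast
      rw [pow_succ]
      linarith
  have h0 := ha.pos 0 (h 0 le_rfl)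
  obtain ⟨k, hk⟩ := pow_unbounded_of_one_lt (t / a 0) (one_lt_two)
  refine ⟨k, by omega, lt_of_lt_of_le ?_ (key k)⟩
  rwa [div_lt_iff₀ h0] at hk

theorem IsLacunarySeq.exists_lt (ha : IsLacunarySeq J a) (h : ∀ n : ℤ, n ≤ 0 → n ∈ J) {t : ℝ}
    (ht : 0 < t) : ∃ n : ℤ, n ≤ 0 ∧ a n < t := by
  have key : ∀ k : ℕ, 2 ^ k * a (-k) ≤ a 0 := by
    intro k
    induction k with
    | zero => simp
    | succ k ih =>
      have := ha.two_mul_le (-(k + 1)) (h _ (by omega)) (h _ (by omega))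
      rw [show -((k : ℤ) + 1) + 1 = -k by ring] at this
      push_cast
      rw [pow_succ]
      have h2 : (0 : ℝ) < 2 ^ k := by positivity
      nlinarith
  obtain ⟨k, hk⟩ := pow_unbounded_of_one_lt (a 0 / t) (one_lt_two)
  refine ⟨-k, by omega, ?_⟩
  rw [div_lt_iff₀ ht] at hk
  have h2 : (0 : ℝ) < 2 ^ k := by positivity
  have := key k
  exact lt_of_mul_lt_mul_left (this.trans_lt hk) h2.le

/-- `n₀(t)` separates the `n ∈ J` with `a_n < t` from those with `a_n ≥ t`. -/
theorem IsLacunarySeq.n₀_lt_iff (ha : IsLacunarySeq J a) {t : ℝ} (ht : 0 < t) {n : ℤ}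
    (hn : n ∈ J) : n₀ J a t < n ↔ t ≤ a n := by
  have hmono : ∀ {p q : ℤ}, p ∈ J → q ∈ J → p ≤ q → a p ≤ a q := by
    intro p q hp hq hpq
    rcases hpq.eq_or_lt with rfl | h
    · exact le_rfl
    · exact (ha.lt_of_lt hp hq h).le
  have up' : (∀ n : ℤ, n ∈ J → n + 1 ∈ J → a n < t → a (n + 1) < t) →
      ∀ p q : ℤ, p ∈ J → q ∈ J → p ≤ q → a p < t → a q < t := by
    intro h p q hp hq hpq hpt
    have up : ∀ k : ℕ, p + k ∈ J → a (p + k) < t := by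
      intro k
      induction k with
      | zero => intro _; simpa using hpt
      | succ k ih =>
        intro hk
        have hk' : p + k ∈ J := by
          rcases ha.index with rfl | rfl | rfl
          · trivial
          · simp only [mem_Ici] at hp ⊢; omega
          · simp only [mem_Iic] at hk ⊢; push_cast at hk; omega
        push_cast at hk ⊢
        rw [← add_assoc] at hk ⊢
        exact h _ hk' hk (ih hk')
    obtain ⟨k, hk⟩ := Int.le.dest hpq
    rw [← hk]
    exact up k (by rw [hk]; exact hq)
  unfold n₀
  split_ifs with h h0
  · obtain ⟨h1, h2, h3, h4⟩ := h.choose_spec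
    constructor
    · intro hlt
      exact h4.trans (hmono h2 hn (by omega))
    · intro hle
      by_contra hcon
      have := hmono hn h1 (not_lt.1 hcon)
      linarith
  all_goals push Not at h
  all_goals replace up' := up' h
  · have hJ : J = Iic 0 := by
      by_contra hne
      have hJ' : ∀ n : ℤ, 0 ≤ n → n ∈ J := by
        intro m hm
        rcases ha.index with rfl | rfl | rfl
        · trivial
        · exact hm
        · exact absurd rfl hne
      obtain ⟨m, hm, hmt⟩ := ha.exists_gt hJ' t
      exact absurd (up' 0 m (hJ' 0 le_rfl) (hJ' m hm) hm h0) (not_lt.2 hmt.le)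
    subst hJ
    simp only [mem_Iic] at hn
    have := hmono hn (show (0 : ℤ) ∈ Iic 0 by simp) hn
    constructor
    · intro; omega
    · intro; linarith
  · have hJ : J = Ici 0 := by
      by_contra hne
      have hJ' : ∀ n : ℤ, n ≤ 0 → n ∈ J := by
        intro m hm
        rcases ha.index with rfl | rfl | rfl
        · trivial
        · exact absurd rfl hne
        · exact hm
      obtain ⟨m, hm, hmt⟩ := ha.exists_lt hJ' ht
      exact h0 (up' m 0 (hJ' m hm) (hJ' 0 le_rfl) hm hmt)
    subst hJ
    have hn' : (0 : ℤ) ≤ n := hn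
    have := hmono (show (0 : ℤ) ∈ Ici 0 by simp) hn hn'
    constructor
    · intro
      exact (not_lt.1 h0).trans this
    · intro; omega

/-- If `n₀(t)` is not in `J`, then `n₀(t) = -1` and `J = ℤ₊`. -/
theorem IsLacunarySeq.lt_of_n₀_notMem (ha : IsLacunarySeq J a) {t : ℝ} (h0 : n₀ J a t ∉ J)
    {n : ℤ} (hn : n ∈ J) : n₀ J a t < n := by
  have h00 : (0 : ℤ) ∈ J := by rcases ha.index with rfl | rfl | rfl <;> simp
  revert h0
  unfold n₀
  split_ifs with h h1
  · exact fun h0 => absurd h.choose_spec.1 h0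
  · exact fun h0 => absurd h00 h0
  · intro h0
    rcases ha.index with rfl | rfl | rfl
    · simp at h0
    · simp only [mem_Ici] at hn; omega
    · simp at h0

/-- A description of `I_n(t)` that does not refer to `n₀(t)`. -/
theorem IsLacunarySeq.mem_I_iff (ha : IsLacunarySeq J a) {t : ℝ} (ht : 0 < t) {n : ℤ} {x : ℝ} :
    x ∈ I J a t n ↔ n ∈ J ∧ 0 ≤ x ∧ a n - t < x ∧ x ≤ a n ∧ x ≤ 2 * a n - t := by
  unfold I
  split_ifs with h1 h2 h3
  · have h4 : ¬ t ≤ a n := by rw [← ha.n₀_lt_iff ht h2, ← h1]; exact lt_irrefl _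
    simp only [mem_Icc, h2, true_and]
    constructor
    · rintro ⟨h5, h6⟩; refine ⟨h5, ?_, ?_, h6⟩ <;> linarith
    · rintro ⟨h5, -, -, h6⟩; exact ⟨h5, h6⟩
  · simp only [mem_Icc, h2, false_and, iff_false]
    rintro ⟨h5, h6⟩; linarith
  · have h4 := (ha.n₀_lt_iff ht h3.1).1 h3.2
    simp only [mem_Ioc, h3.1, true_and]
    constructor
    · rintro ⟨h5, h6⟩; refine ⟨?_, h5, h6, ?_⟩ <;> linarith
    · rintro ⟨-, h5, h6, -⟩; exact ⟨h5, h6⟩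
  · simp only [mem_empty_iff_false, false_iff]
    rintro ⟨h4, h5, h6, h7, h8⟩
    have h9 : ¬ n₀ J a t < n := fun h => h3 ⟨h4, h⟩
    have h10 : n < n₀ J a t := lt_of_le_of_ne (not_lt.1 h9) h1
    have h11 : n₀ J a t ∈ J := by
      by_contra hc
      exact h9 (ha.lt_of_n₀_notMem hc h4)
    have h12 := ha.two_mul_le_of_lt h4 h11 h10
    have h13 : ¬ t ≤ a (n₀ J a t) := by rw [← ha.n₀_lt_iff ht h11]; exact lt_irrefl _
    linarith

theorem IsLacunarySeq.eq_of_mem_I (ha : IsLacunarySeq J a) {t : ℝ} (ht : 0 < t) {m n : ℤ} {x : ℝ}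
    (hm : x ∈ I J a t m) (hn : x ∈ I J a t n) : m = n := by
  rw [ha.mem_I_iff ht] at hm hn
  obtain ⟨hm1, hm2, hm3, hm4, hm5⟩ := hm
  obtain ⟨hn1, hn2, hn3, hn4, hn5⟩ := hn
  rcases lt_trichotomy m n with h | h | h
  · have := ha.two_mul_le_of_lt hm1 hn1 h
    linarith
  · exact h
  · have := ha.two_mul_le_of_lt hn1 hm1 h
    linarith

theorem measurableSet_I (J : Set ℤ) (a : ℤ → ℝ) (t : ℝ) (n : ℤ) : MeasurableSet (I J a t n) := by
  unfold I
  split_ifs <;> measurability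

end Intervals

open Classical in
/-- The `n` with `x ∈ I_n(t)`; the value `0` for `x` outside all `I_n(t)` plays no role. -/
def blockIndex (J : Set ℤ) (a : ℤ → ℝ) (t x : ℝ) : ℤ :=
  if h : ∃ n, x ∈ I J a t n then h.choose else 0

/-- The map `x ↦ 2 a_n - x - t` for `x ∈ I_n(t)`. -/
def reflect (J : Set ℤ) (a : ℤ → ℝ) (t x : ℝ) : ℝ := 2 * a (blockIndex J a t x) - x - t

section Reflect

variable {J : Set ℤ} {a : ℤ → ℝ}

theorem IsLacunarySeq.blockIndex_eq (ha : IsLacunarySeq J a) {t : ℝ} (ht : 0 < t) {n : ℤ} {x : ℝ}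
    (hx : x ∈ I J a t n) : blockIndex J a t x = n := by
  have h : ∃ n, x ∈ I J a t n := ⟨n, hx⟩
  unfold blockIndex
  rw [dif_pos h]
  exact ha.eq_of_mem_I ht h.choose_spec hx

theorem IsLacunarySeq.measurable_reflect (ha : IsLacunarySeq J a) {t : ℝ} (ht : 0 < t) :
    Measurable (reflect J a t) := by
  have hB : Measurable (blockIndex J a t) := by
    refine measurable_to_countable' fun n => ?_
    have : blockIndex J a t ⁻¹' {n} =
        I J a t n ∪ ((⋃ m, I J a t m)ᶜ ∩ {_x : ℝ | n = 0}) := by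
      ext x
      simp only [mem_preimage, mem_singleton_iff, mem_union, mem_inter_iff, mem_compl_iff,
        mem_iUnion, mem_ofPred_eq]
      by_cases h : ∃ m, x ∈ I J a t m
      · obtain ⟨m, hm⟩ := h
        rw [ha.blockIndex_eq ht hm]
        constructor
        · rintro rfl; exact Or.inl hm
        · rintro (h | h)
          · exact ha.eq_of_mem_I ht hm h
          · exact absurd ⟨m, hm⟩ h.1
      · have h1 : blockIndex J a t x = 0 := dif_neg h
        rw [h1]
        constructor
        · rintro rfl; exact Or.inr ⟨h, rfl⟩
        · rintro (h2 | h2)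
          · exact absurd ⟨n, h2⟩ h
          · exact h2.2.symm
    rw [this]
    exact (measurableSet_I J a t n).union
      ((MeasurableSet.iUnion (measurableSet_I J a t)).compl.inter (MeasurableSet.const _))
  have h1 : Measurable fun x => a (blockIndex J a t x) := (measurable_of_countable a).comp hB
  exact ((h1.const_mul 2).sub measurable_id).sub_const t

theorem IsLacunarySeq.map_reflect_le (ha : IsLacunarySeq J a) {t : ℝ} (ht : 0 < t) :
    (halfLine.restrict (⋃ n, I J a t n)).map (reflect J a t) ≤ halfLine := by
  have hφ := ha.measurable_reflect ht
  refine Measure.le_iff.2 fun B hB => ?_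
  rw [Measure.map_apply hφ hB, Measure.restrict_apply (hφ hB), Measure.restrict_apply hB]
  set K : ℤ → Set ℝ := fun n => (B ∩ (fun y => 2 * a n - t - y) ⁻¹' I J a t n) with hK
  have hKm : ∀ n, MeasurableSet (K n) := fun n =>
    hB.inter ((measurable_const.sub measurable_id) (measurableSet_I J a t n))
  have hmem : ∀ n y, y ∈ K n → n ∈ J ∧ 0 ≤ y ∧ a n - t ≤ y ∧ y ≤ 2 * a n - t := by
    rintro n y ⟨-, hy⟩
    obtain ⟨h1, h2, h3, h4, h5⟩ := (ha.mem_I_iff ht).1 hy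
    exact ⟨h1, by linarith, by linarith, by linarith⟩
  have hdis : Pairwise (Function.onFun (AEDisjoint volume) K) := by
    have key : ∀ m n, m < n → AEDisjoint volume (K m) (K n) := by
      intro m n hmn
      refine measure_mono_null (t := {a n - t}) ?_ (by simp)
      rintro y ⟨hm, hn⟩
      obtain ⟨h1, -, -, h2⟩ := hmem m y hm
      obtain ⟨h3, -, h4, -⟩ := hmem n y hn
      have := ha.two_mul_le_of_lt h1 h3 hmn
      exact le_antisymm (by linarith) h4
    intro m n hmn
    rcases lt_or_gt_of_ne hmn with h | h
    · exact key m n h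
    · exact (key n m h).symm
  calc halfLine (reflect J a t ⁻¹' B ∩ ⋃ n, I J a t n)
      ≤ volume (reflect J a t ⁻¹' B ∩ ⋃ n, I J a t n) := Measure.restrict_apply_le _ _
    _ ≤ volume (⋃ n, (fun x => 2 * a n - t - x) ⁻¹' K n) := by
        refine measure_mono ?_
        rintro x ⟨hx, hx'⟩
        obtain ⟨n, hn⟩ := mem_iUnion.1 hx'
        refine mem_iUnion.2 ⟨n, ?_, ?_⟩
        · have : reflect J a t x = 2 * a n - t - x := by
            unfold reflect
            rw [ha.blockIndex_eq ht hn]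
            ring
          rw [mem_preimage, this] at hx
          exact hx
        · simpa using hn
    _ ≤ ∑' n, volume ((fun x => 2 * a n - t - x) ⁻¹' K n) := measure_iUnion_le _
    _ = ∑' n, volume (K n) := by
        congr 1
        ext n
        exact (Measure.measurePreserving_sub_left volume (2 * a n - t)).measure_preimage
          (hKm n).nullMeasurableSet
    _ = volume (⋃ n, K n) := (measure_iUnion₀ hdis fun n => (hKm n).nullMeasurableSet).symm
    _ ≤ volume (B ∩ Ici 0) := by
        refine measure_mono (iUnion_subset fun n y hy => ⟨hy.1, (hmem n y hy).2.1⟩)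

end Reflect

open Classical in
/-- For `t > 0`, `(V_a(t) f)(x) = f (2 a_n - x - t)` if `x ∈ I_n(t)`, and `0` if `x` is in no
`I_n(t)`; and `V_a(0) = 0`. -/
def V (J : Set ℤ) (a : ℤ → ℝ) (ha : IsLacunarySeq J a) (t : ℝ) : L2 →L[ℂ] L2 :=
  if ht : 0 < t then
    partialComp (reflect J a t) (⋃ n, I J a t n) (ha.measurable_reflect ht)
      (MeasurableSet.iUnion (measurableSet_I J a t)) (ha.map_reflect_le ht)
  else 0

/-- The formula that defines `V_a(t)`. -/
theorem coeFn_V {J : Set ℤ} {a : ℤ → ℝ} (ha : IsLacunarySeq J a) {t : ℝ} (ht : 0 < t) (f : L2) :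
    ∀ᵐ x ∂halfLine, (∀ n, x ∈ I J a t n → V J a ha t f x = f (2 * a n - x - t)) ∧
      ((∀ n, x ∉ I J a t n) → V J a ha t f x = 0) := by
  unfold V
  rw [dif_pos ht]
  filter_upwards [coeFn_partialComp (reflect J a t) (⋃ n, I J a t n) (ha.measurable_reflect ht)
      (MeasurableSet.iUnion (measurableSet_I J a t)) (ha.map_reflect_le ht) f] with x hx
  rw [hx]
  constructor
  · intro n hn
    rw [indicator_of_mem (mem_iUnion.2 ⟨n, hn⟩), reflect, ha.blockIndex_eq ht hn]
  · intro h
    exact indicator_of_notMem (by simpa using h) _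

/-- The Hilbert space `L²(ℝ₊) ⊕ L²(ℝ₊)` (orthogonal direct sum). -/
abbrev L2Sum : Type := WithLp 2 (L2 × L2)

/-- The Packel-type semigroup: `T_a(t)` is the block operator matrix with rows
`(L(t), V_a(t))` and `(0, R(t))`, so that `T_a(t) (f, g) = (L(t) f + V_a(t) g, R(t) g)`. -/
def T (J : Set ℤ) (a : ℤ → ℝ) (ha : IsLacunarySeq J a) (t : ℝ) : L2Sum →L[ℂ] L2Sum :=
  ((WithLp.prodContinuousLinearEquiv 2 ℂ L2 L2).symm : L2 × L2 →L[ℂ] L2Sum) ∘L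
    (((leftShift t).coprod (V J a ha t)).prod
      (rightShift t ∘L ContinuousLinearMap.snd ℂ L2 L2)) ∘L
    ((WithLp.prodContinuousLinearEquiv 2 ℂ L2 L2) : L2Sum →L[ℂ] L2 × L2)

end PackelSemigroup

end

/-! Think of the second component as moving right and of the first as moving left. A
second-component particle passing $a_n$ keeps going and emits a copy into the first component; the
copy starts at $a_n$ and moves left. It leaves the half-line when the emitter reaches $2a_n\le
a_{n+1}$, so an emitter has at most one copy alive at a time. Splitting emissions into those before
and those after an intermediate time gives the cocycle identity `V_add`, hence the semigroup law.
Strong continuity holds because a fixed $x>0$ has no $a_n$ in $(x,x+t]$ for small $t$.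

Positive results. For $J=\mathbb Z_-$ nothing is emitted beyond $a_0$, so $V(t)=L(t)Z-ZR(t)$ with a
finite sum $Z$ (`exists_commutator`), and a shear turns $T(t)$ into $L(t)\oplus R(t)$. For
$J=\mathbb Z_+$ the points $a_n$ are at least $a_0$ apart. Weights that drop as a particle crosses
$a_n$, in its direction of motion, pay for each emission, up to growth $e^{\lambda t}$ with
$\lambda=4/a_0$ (`two_mul_weight_le`, `weight_add_four_le`).

Negative results. Both come from `exists_no_reflection_system`, applied to an equivalent norm
$\|U\cdot\|$. Suitable times send $\mu E_k+G_k$ to $(1+\mu)F_j+D_{jk}$ for $j<k$ and $F_l$ to $E_k$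
for $k<l$. If these maps almost decrease the norm, pigeonholing makes $\|UE_k\|^2$ at most barely
larger than $\|UF_j\|^2$ for a long run of $k$. Bessel's inequality then finds a $k$ with negligible
cross terms, and comparing $(1+\mu)^2$ with $\mu^2$ is absurd for large $\mu$. The vectors are bumps
at finitely many consecutive $a_n$. Large $a_n$ are used against one contraction, where rounding
times to multiples of $t$ is harmless for wide bumps. Small $a_n$ are used against
quasi-contractions, where $e^{\lambda s}\approx1$. For $J=\mathbb Z$ both ends are available. -/

noncomputable section

namespace PackelSemigroup

/-! ### A finite obstruction to equivalent contractive norms -/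

section Obstruction

variable {H : Type*} [NormedAddCommGroup H] [InnerProductSpace ℂ H]

/-- Bessel's inequality for a finite orthonormal family given by a finite set of indices. -/
theorem sum_sq_inner_le_of_orthonormalOn {ι : Type*} {s : Finset ι} {v : ι → H}
    (hn : ∀ i ∈ s, ‖v i‖ = 1) (ho : ∀ i ∈ s, ∀ j ∈ s, i ≠ j → inner ℂ (v i) (v j) = 0) (x : H) :
    ∑ i ∈ s, ‖inner ℂ (v i) x‖ ^ 2 ≤ ‖x‖ ^ 2 := by
  have hv : Orthonormal ℂ (fun i : s => v i) :=
    ⟨fun i => hn i i.2, fun i j hij => ho i i.2 j j.2 fun h => hij (Subtype.ext h)⟩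
  have h := hv.sum_inner_products_le (s := Finset.univ) (x := x)
  rwa [Finset.sum_coe_sort s (fun i => ‖inner ℂ (v i) x‖ ^ 2)] at h

/-- Otherwise `P` increments larger than `θ` would push `v P` above `B`. -/
theorem exists_le_succ_add {v : ℕ → ℝ} {B θ : ℝ} {P : ℕ} (hP : B < P * θ)
    (h0 : 0 ≤ v 0) (hB : v P ≤ B) : ∃ i < P, v (i + 1) ≤ v i + θ := by
  by_contra! hcon
  have key : ∀ i ≤ P, i * θ ≤ v i := by
    intro i
    induction i with
    | zero => intro _; simpa using h0
    | succ i ih =>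
      intro hi
      have h1 := ih (by omega)
      have h2 := hcon i (by omega)
      push_cast
      linarith
  linarith [key P le_rfl]

/-- The numerical end of the obstruction, with $\mu=8K^4$, $f=\|UF_j\|^2$, $e=\|UE_k\|^2$,
$g=\|UG_k\|^2$, $d=\|UD_{jk}\|^2$ and cross terms $X,Y$. After cancelling $\mu^2f$ the left side
keeps $2\mu f\ge16K^2$, while $(1+\varepsilon)g\le8K^2$. The errors add up to at most
$(2\mu^2+6\mu+2)\kappa$, which is below $1$ by the choice of $\kappa$. -/
theorem weighted_reflection_absurd {K κ ε f e g d X Y : ℝ} (hK : 1 ≤ K)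
    (hκ : κ = 1 / (4 * (8 * K ^ 4 + 1) ^ 2)) (hε : 0 < ε) (hε' : ε * K ^ 2 ≤ κ)
    (hf : 1 / K ^ 2 ≤ f) (he : e ≤ K ^ 2) (hef : e ≤ f + κ) (hX : |X| ≤ κ)
    (hY : |Y| ≤ κ) (hg0 : 0 ≤ g) (hg : g ≤ 4 * K ^ 2) (hd : 0 ≤ d)
    (h : (1 + 8 * K ^ 4) ^ 2 * f + 2 * (1 + 8 * K ^ 4) * Y + d ≤
      (1 + ε) * ((8 * K ^ 4) ^ 2 * e + 2 * (8 * K ^ 4) * X + g)) : False := by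
  have hK2 : 1 ≤ K ^ 2 := one_le_pow₀ hK
  have hf' : 16 * K ^ 2 ≤ 2 * (8 * K ^ 4) * f := by
    rw [div_le_iff₀ (by positivity)] at hf
    nlinarith
  have hμ0 : 0 ≤ 8 * K ^ 4 := by positivity
  generalize 8 * K ^ 4 = μ at *
  have hκ4 : κ * (4 * (μ + 1) ^ 2) = 1 := by
    rw [hκ]; field_simp
  have hκ0 : 0 < κ := by rw [hκ]; positivity
  clear hκ
  have hε1 : ε ≤ 1 := by
    have : κ ≤ 1 := by
      linarith [mul_nonneg hκ0.le hμ0, mul_nonneg hκ0.le (sq_nonneg μ)]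
    linarith [mul_le_mul_of_nonneg_left hK2 hε.le]
  have h1 : ε * (μ ^ 2 * e) ≤ μ ^ 2 * κ := by
    have : ε * e ≤ κ := (mul_le_mul_of_nonneg_left he hε.le).trans hε'
    linarith [mul_le_mul_of_nonneg_left this (sq_nonneg μ)]
  have h2 : (1 + ε) * (2 * μ * X) ≤ 4 * μ * κ := by
    have hX' := (le_abs_self X).trans hX
    have h3 : (1 + ε) * X ≤ (1 + ε) * κ := mul_le_mul_of_nonneg_left hX' (by linarith)
    have h4 : ε * κ ≤ 1 * κ := mul_le_mul_of_nonneg_right hε1 hκ0.le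
    have h5 : (1 + ε) * X ≤ 2 * κ := by linarith
    linarith [mul_le_mul_of_nonneg_left h5 hμ0]
  have h3 : (1 + ε) * g ≤ 8 * K ^ 2 := by
    linarith [mul_le_mul_of_nonneg_right hε1 hg0]
  have h5 : μ ^ 2 * e ≤ μ ^ 2 * f + μ ^ 2 * κ := by
    linarith [mul_le_mul_of_nonneg_left hef (sq_nonneg μ)]
  have h6 : 0 ≤ (1 + μ) * (Y + κ) := mul_nonneg (by linarith) (by linarith [(abs_le.1 hY).1])
  have hf0 : 0 ≤ f := le_trans (by positivity) hf
  linarith [mul_nonneg hκ0.le hμ0, mul_nonneg hκ0.le (sq_nonneg μ)]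

theorem norm_sq_real_smul_add (U : H →L[ℂ] H) (c : ℝ) (x y : H) :
    ‖U ((c : ℂ) • x + y)‖ ^ 2 =
      c ^ 2 * ‖U x‖ ^ 2 + 2 * c * (inner ℂ (U x) (U y)).re + ‖U y‖ ^ 2 := by
  rw [map_add, map_smul, norm_add_sq (𝕜 := ℂ), norm_smul, inner_smul_left]
  simp [mul_pow]
  ring

variable [CompleteSpace H]

/-- An equivalent Hilbert norm `x ↦ ‖U x‖` cannot be almost nonincreasing along a large system of
reflections: here `F j` and `E k` are the incoming and outgoing positions in the first component,
`G k` and `D j k` those in the second one. -/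
theorem exists_no_reflection_system (K : ℝ) (hK : 1 ≤ K) : ∃ (N : ℕ) (ε : ℝ), 0 < ε ∧
    ∀ (U : H →L[ℂ] H), (∀ h, ‖U h‖ ≤ K * ‖h‖) → (∀ h, ‖h‖ ≤ K * ‖U h‖) →
    ∀ (F E G : ℕ → H) (G₀ : H) (D : ℕ → ℕ → H),
    (∀ j ≤ N, ‖F j‖ = 1) → (∀ k ≤ N, ‖E k‖ = 1) → ‖G₀‖ = 1 →
    (∀ k ≤ N, ∀ l ≤ N, k ≠ l → inner ℂ (E k) (E l) = 0) →
    (∀ k ≤ N, ‖G k - G₀‖ ≤ ε) →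
    (∀ j k, j < k → k ≤ N → ‖D j k‖ = 1) →
    (∀ j k l, j < k → k ≤ N → j < l → l ≤ N → k ≠ l → inner ℂ (D j k) (D j l) = 0) →
    (∀ j k, j < k → k ≤ N → ∀ μ : ℝ,
      ‖U (((1 + μ : ℝ) : ℂ) • F j + D j k)‖ ^ 2 ≤ (1 + ε) * ‖U ((μ : ℂ) • E k + G k)‖ ^ 2) →
    (∀ k l, k < l → l ≤ N → ‖U (E k)‖ ^ 2 ≤ (1 + ε) * ‖U (F l)‖ ^ 2) → False := by
  have hK2 : 1 ≤ K ^ 2 := one_le_pow₀ hK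
  set κ : ℝ := 1 / (4 * (8 * K ^ 4 + 1) ^ 2) with hκ
  have hκ0 : 0 < κ := by positivity
  have hκ1 : κ ≤ 1 := by
    rw [hκ, div_le_one (by positivity)]
    nlinarith [show 0 ≤ K ^ 4 by positivity]
  -- `M` is the length of a run in which Bessel must produce two small cross terms at once, the
  -- total budget being $2K^4$. `P` is the number of runs needed to find one along which $\|UF\|^2$
  -- grows by at most $\kappa/2$.
  obtain ⟨M, hM⟩ := exists_nat_gt (2 * K ^ 4 / (κ / 2) ^ 2)
  obtain ⟨P, hP⟩ := exists_nat_gt (K ^ 2 / (κ / 2))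
  rw [div_lt_iff₀ (by positivity)] at hM hP
  set ε : ℝ := κ / 2 / K ^ 2 with hε
  have hεK : ε * K ^ 2 = κ / 2 := by rw [hε]; field_simp
  have hε0 : 0 < ε := by positivity
  have hε1 : ε ≤ 1 := by nlinarith
  -- Runs have length `M + 1`, so that the `M` candidates `k` lie strictly between the two ends of a
  -- run and the monotonicity hypothesis applies between `k` and the right end.
  refine ⟨P * (M + 1), ε, hε0, ?_⟩
  intro U hU hU' F E G G₀ D hF hE hG0 hEo hG hD hDo hrefl hmon
  have hup : ∀ h, ‖h‖ = 1 → ‖U h‖ ^ 2 ≤ K ^ 2 := fun h h1 => by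
    have := hU h
    rw [h1, mul_one] at this
    exact pow_le_pow_left₀ (norm_nonneg _) this 2
  obtain ⟨i, hiP, hi⟩ := exists_le_succ_add (v := fun i => ‖U (F (i * (M + 1)))‖ ^ 2)
    (B := K ^ 2) (θ := κ / 2) hP (by positivity) (hup _ (hF _ le_rfl))
  set j := i * (M + 1) with hj
  have hjM : j + (M + 1) ≤ P * (M + 1) := by
    have : (i + 1) * (M + 1) ≤ P * (M + 1) := Nat.mul_le_mul_right _ hiP
    rw [hj]; linarith [add_one_mul i (M + 1)]
  rw [show (i + 1) * (M + 1) = j + (M + 1) by rw [hj]; ring] at hi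
  -- With $A=U^*U$ the cross terms become coefficients of the fixed vectors $AG_0$ and $AF_j$
  -- against orthonormal families in `k`. This is why `G k` has to stay close to a single `G₀`.
  set A : H →L[ℂ] H := ContinuousLinearMap.adjoint U ∘L U with hA
  have hAin : ∀ x y : H, inner ℂ (U x) (U y) = inner ℂ x (A y) := fun x y => by
    simp [hA, ContinuousLinearMap.adjoint_inner_right]
  have hAn : ∀ x, ‖x‖ = 1 → ‖A x‖ ^ 2 ≤ K ^ 4 := fun x hx => by
    have h1 : ‖U‖ ≤ K := U.opNorm_le_bound (by linarith) hU
    have h2 : ‖A x‖ ≤ K * K := by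
      calc ‖A x‖ = ‖ContinuousLinearMap.adjoint U (U x)‖ := rfl
        _ ≤ ‖ContinuousLinearMap.adjoint U‖ * ‖U x‖ := ContinuousLinearMap.le_opNorm _ _
        _ = ‖U‖ * ‖U x‖ := by rw [LinearIsometryEquiv.norm_map]
        _ ≤ K * (K * ‖x‖) := by gcongr; exact hU x
        _ = K * K := by rw [hx, mul_one]
    calc ‖A x‖ ^ 2 ≤ (K * K) ^ 2 := pow_le_pow_left₀ (norm_nonneg _) h2 2
      _ = K ^ 4 := by ring
  have hsum : ∑ k ∈ Finset.Ioc j (j + M),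
      (‖inner ℂ (E k) (A G₀)‖ ^ 2 + ‖inner ℂ (D j k) (A (F j))‖ ^ 2) ≤
        ∑ _k ∈ Finset.Ioc j (j + M), (κ / 2) ^ 2 := by
    rw [Finset.sum_add_distrib, Finset.sum_const, Nat.card_Ioc, nsmul_eq_mul]
    have hmem : ∀ k ∈ Finset.Ioc j (j + M), j < k ∧ k ≤ P * (M + 1) := fun k hk => by
      rw [Finset.mem_Ioc] at hk; omega
    have h1 := sum_sq_inner_le_of_orthonormalOn (s := Finset.Ioc j (j + M)) (v := E)
      (fun k hk => hE k (hmem k hk).2)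
      (fun k hk l hl h => hEo k (hmem k hk).2 l (hmem l hl).2 h) (A G₀)
    have h2 := sum_sq_inner_le_of_orthonormalOn (s := Finset.Ioc j (j + M)) (v := D j)
      (fun k hk => hD j k (hmem k hk).1 (hmem k hk).2)
      (fun k hk l hl h => hDo j k l (hmem k hk).1 (hmem k hk).2 (hmem l hl).1 (hmem l hl).2 h)
      (A (F j))
    have h3 := hAn _ hG0
    have h4 := hAn _ (hF j (by omega))
    rw [show j + M - j = M by omega]
    linarith
  have hM0 : 0 < M := by
    rcases Nat.eq_zero_or_pos M with h | h
    · rw [h, Nat.cast_zero, zero_mul] at hM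
      exact absurd hM (not_lt.2 (by positivity))
    · exact h
  obtain ⟨k, hk, hkle⟩ := Finset.exists_le_of_sum_le
    (Finset.nonempty_Ioc.2 (by omega : j < j + M)) hsum
  rw [Finset.mem_Ioc] at hk
  have hkN : k ≤ P * (M + 1) := by omega
  have hX0 : ‖inner ℂ (E k) (A G₀)‖ ≤ κ / 2 :=
    abs_le_of_sq_le_sq' (by nlinarith [sq_nonneg ‖inner ℂ (D j k) (A (F j))‖]) (by positivity) |>.2
  have hY0 : ‖inner ℂ (D j k) (A (F j))‖ ≤ κ / 2 :=
    abs_le_of_sq_le_sq' (by nlinarith [sq_nonneg ‖inner ℂ (E k) (A G₀)‖]) (by positivity) |>.2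
  have hX : |(inner ℂ (U (E k)) (U (G k))).re| ≤ κ := by
    refine (Complex.abs_re_le_norm _).trans ?_
    have h1 : inner ℂ (U (E k)) (U (G k)) =
        inner ℂ (E k) (A G₀) + inner ℂ (U (E k)) (U (G k - G₀)) := by
      rw [← hAin, ← inner_add_right, ← map_add]; simp
    have h2 : ‖inner ℂ (U (E k)) (U (G k - G₀))‖ ≤ κ / 2 := by
      calc ‖inner ℂ (U (E k)) (U (G k - G₀))‖ ≤ ‖U (E k)‖ * ‖U (G k - G₀)‖ := norm_inner_le_norm _ _
        _ ≤ (K * ‖E k‖) * (K * ‖G k - G₀‖) := by gcongr <;> exact hU _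
        _ ≤ (K * 1) * (K * ε) := by rw [hE k hkN]; gcongr; exact hG k hkN
        _ = κ / 2 := by rw [← hεK]; ring
    rw [h1]
    linarith [norm_add_le (inner ℂ (E k) (A G₀)) (inner ℂ (U (E k)) (U (G k - G₀)))]
  have hY : |(inner ℂ (U (F j)) (U (D j k))).re| ≤ κ := by
    refine (Complex.abs_re_le_norm _).trans ?_
    rw [← inner_conj_symm, RCLike.norm_conj, hAin]
    linarith
  have hGn : ‖U (G k)‖ ^ 2 ≤ 4 * K ^ 2 := by
    have h1 : ‖G k‖ ≤ 2 := by
      have := norm_add_le (G k - G₀) G₀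
      rw [sub_add_cancel, hG0] at this
      linarith [hG k hkN]
    have h2 : ‖U (G k)‖ ≤ K * 2 := (hU _).trans (by gcongr)
    calc ‖U (G k)‖ ^ 2 ≤ (K * 2) ^ 2 := pow_le_pow_left₀ (norm_nonneg _) h2 2
      _ = 4 * K ^ 2 := by ring
  have hFl : 1 / K ^ 2 ≤ ‖U (F j)‖ ^ 2 := by
    have h1 := hU' (F j)
    rw [hF j (by omega)] at h1
    rw [div_le_iff₀ (by positivity), ← mul_pow]
    exact one_le_pow₀ (by linarith)
  have hEF : ‖U (E k)‖ ^ 2 ≤ ‖U (F j)‖ ^ 2 + κ := by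
    have h1 := hmon k (j + (M + 1)) (by omega) hjM
    have h2 := hup _ (hF (j + (M + 1)) hjM)
    nlinarith [mul_le_mul_of_nonneg_left h2 hε0.le]
  have h := hrefl j k hk.1 hkN (8 * K ^ 4)
  rw [norm_sq_real_smul_add, norm_sq_real_smul_add] at h
  exact weighted_reflection_absurd hK hκ hε0 (by linarith) hFl (hup _ (hE k hkN)) hEF hX hY
    (sq_nonneg _) hGn (sq_nonneg _) h

end Obstruction

/-! ### Shifts -/

theorem norm_partialComp_apply_le (φ : ℝ → ℝ) (S : Set ℝ) (hφ : Measurable φ)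
    (hS : MeasurableSet S) (hle : (halfLine.restrict S).map φ ≤ halfLine) (f : L2) :
    ‖partialComp φ S hφ hS hle f‖ ≤ ‖f‖ := by
  have h := (partialComp φ S hφ hS hle).le_of_opNorm_le
    (LinearMap.mkContinuous_norm_le _ zero_le_one _) f
  rwa [one_mul] at h

theorem ae_nonneg_halfLine : ∀ᵐ x ∂halfLine, 0 ≤ x :=
  ae_restrict_mem measurableSet_Ici

theorem ae_shift (s : ℝ) {p : ℝ → Prop} (hp : ∀ᵐ y ∂halfLine, p y) :
    ∀ᵐ x ∂halfLine, 0 ≤ x + s → p (x + s) :=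
  ae_partialComp (fun x => x + s) {x | 0 ≤ x + s} (measurable_id.add_const s)
    (measurableSet_le measurable_const (measurable_id.add_const s)) (map_shift_le s) hp

theorem coeFn_shift (s : ℝ) (f : L2) : ∀ᵐ x ∂halfLine,
    (0 ≤ x + s → shift s f x = f (x + s)) ∧ (x + s < 0 → shift s f x = 0) := by
  filter_upwards [coeFn_partialComp (fun x => x + s) {x | 0 ≤ x + s} (measurable_id.add_const s)
    (measurableSet_le measurable_const (measurable_id.add_const s)) (map_shift_le s) f] with x hx
  refine ⟨fun h => ?_, fun h => ?_⟩
  · exact hx.trans (indicator_of_mem (s := {x : ℝ | 0 ≤ x + s}) h _)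
  · exact hx.trans (indicator_of_notMem (s := {x : ℝ | 0 ≤ x + s}) (not_le.2 h) _)

theorem norm_shift_apply_le (s : ℝ) (f : L2) : ‖shift s f‖ ≤ ‖f‖ :=
  norm_partialComp_apply_le _ _ _ _ _ f

/-- The excluded case is $s<0<t$: translating left first discards mass that the right shift cannot
restore. -/
theorem shift_shift {s t : ℝ} (h : 0 ≤ s ∨ t ≤ 0) (f : L2) :
    shift s (shift t f) = shift (s + t) f := by
  refine Lp.ext ?_
  filter_upwards [coeFn_shift s (shift t f), ae_shift s (coeFn_shift t f), coeFn_shift (s + t) f,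
    ae_nonneg_halfLine] with x h1 h2 h3 h4
  rw [← add_assoc] at h3
  rcases le_or_gt 0 (x + s) with h5 | h5
  · rw [h1.1 h5]
    rcases le_or_gt 0 (x + s + t) with h6 | h6
    · rw [(h2 h5).1 h6, h3.1 h6]
    · rw [(h2 h5).2 h6, h3.2 h6]
  · rw [h1.2 h5, h3.2]
    rcases h with h | h <;> linarith

theorem shift_zero (f : L2) : shift 0 f = f := by
  refine Lp.ext ?_
  filter_upwards [coeFn_shift 0 f, ae_nonneg_halfLine] with x h1 h2
  rw [h1.1 (by linarith), add_zero]

/-- Extended by zero to $\mathbb R$, the shift is the restriction of a translation, and translations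
act continuously on $L^2(\mathbb R)$. -/
theorem tendsto_shift (f : L2) : Tendsto (fun s => shift s f) (𝓝 0) (𝓝 f) := by
  have hf : MemLp ((Ici (0 : ℝ)).indicator f) 2 volume :=
    (memLp_indicator_iff_restrict measurableSet_Ici).2 (Lp.memLp f)
  set F : Lp ℂ 2 (volume : Measure ℝ) := hf.toLp _ with hF
  have : Fact ((2 : ENNReal) ≠ ⊤) := ⟨by simp⟩
  have hc : Tendsto (fun s : ℝ => DomAddAct.mk s +ᵥ F) (𝓝 0) (𝓝 F) := by
    have h1 : Continuous fun s : ℝ => DomAddAct.mk s +ᵥ F := by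
      have : Continuous fun s : ℝ => DomAddAct.mk s := DomAddAct.continuous_mk
      fun_prop
    have h2 := h1.tendsto 0
    simpa using h2
  rw [tendsto_iff_norm_sub_tendsto_zero] at hc ⊢
  refine squeeze_zero (fun _ => norm_nonneg _) (fun s => ?_) hc
  rw [Lp.norm_def, Lp.norm_def]
  refine ENNReal.toReal_mono (Lp.eLpNorm_ne_top _) ?_
  refine le_trans ?_ (eLpNorm_mono_measure _ (Measure.restrict_le_self (s := Ici (0 : ℝ))))
  refine le_of_eq (eLpNorm_congr_ae ?_)
  have h1 : (F : ℝ → ℂ) =ᵐ[volume] (Ici (0 : ℝ)).indicator f := hf.coeFn_toLp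
  have h2 : ∀ᵐ x, F (s + x) = (Ici (0 : ℝ)).indicator f (s + x) :=
    (measurePreserving_add_left volume s).quasiMeasurePreserving.ae h1
  filter_upwards [coeFn_shift s f, ae_nonneg_halfLine, Lp.coeFn_sub (shift s f) f,
    ae_restrict_of_ae (Lp.coeFn_sub (DomAddAct.mk s +ᵥ F) F), ae_restrict_of_ae h1,
    ae_restrict_of_ae h2, ae_restrict_of_ae (DomAddAct.vadd_Lp_ae_eq (DomAddAct.mk s) F)]
    with x h3 h4 h5 h6 h7 h8 h9
  rw [h5, h6, Pi.sub_apply, Pi.sub_apply, h7, h9, indicator_of_mem (mem_Ici.2 h4)]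
  congr 1
  rw [vadd_eq_add, Equiv.symm_apply_apply, h8]
  rcases le_or_gt 0 (x + s) with h10 | h10
  · rw [h3.1 h10, add_comm s, indicator_of_mem (mem_Ici.2 h10)]
  · rw [h3.2 h10, add_comm s, indicator_of_notMem (by simpa using h10)]

/-! ### The cocycle `V` -/

section Cocycle

variable {J : Set ℤ} {a : ℤ → ℝ} (ha : IsLacunarySeq J a)
include ha

theorem ae_reflect {t : ℝ} (ht : 0 < t) {p : ℝ → Prop} (hp : ∀ᵐ y ∂halfLine, p y) :
    ∀ᵐ x ∂halfLine, ∀ n, x ∈ I J a t n → p (2 * a n - x - t) := by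
  filter_upwards [ae_partialComp (reflect J a t) (⋃ n, I J a t n) (ha.measurable_reflect ht)
      (MeasurableSet.iUnion (measurableSet_I J a t)) (ha.map_reflect_le ht) hp] with x hx n hn
  have := hx (mem_iUnion.2 ⟨n, hn⟩)
  rwa [reflect, ha.blockIndex_eq ht hn] at this

theorem V_of_nonpos {t : ℝ} (ht : t ≤ 0) : V J a ha t = 0 := dif_neg (not_lt.2 ht)

theorem norm_V_apply_le (t : ℝ) (f : L2) : ‖V J a ha t f‖ ≤ ‖f‖ := by
  rcases lt_or_ge 0 t with ht | ht
  · rw [V, dif_pos ht]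
    exact norm_partialComp_apply_le _ _ _ _ _ f
  · rw [V_of_nonpos ha ht]
    simp

/-- Only particles that cross some $a_n$ within time $t$ emit. This locality lets the bound
$\|V(t)g\|\le\|g\|$ be applied to a cut-off of `g`. -/
theorem V_congr {t : ℝ} {f g : L2} (h : ∀ᵐ y ∂halfLine, 0 ≤ y →
    (∃ n ∈ J, a n - t ≤ y ∧ y < a n) → f y = g y) : V J a ha t f = V J a ha t g := by
  rcases lt_or_ge 0 t with ht | ht
  · refine Lp.ext ?_
    filter_upwards [coeFn_V ha ht f, coeFn_V ha ht g, ae_reflect ha ht h] with x h1 h2 h3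
    by_cases hx : ∃ n, x ∈ I J a t n
    · obtain ⟨n, hn⟩ := hx
      have h4 := (ha.mem_I_iff ht).1 hn
      rw [h1.1 n hn, h2.1 n hn]
      exact h3 n hn (by linarith) ⟨n, h4.1, by linarith, by linarith⟩
    · rw [h1.2 (not_exists.1 hx), h2.2 (not_exists.1 hx)]
  · rw [V_of_nonpos ha ht]
    rfl

/-- A copy is emitted either during the first `t` units of time, and then moves left for `s` more,
or after the emitter has moved right for `t`. Lacunarity excludes both contributions at the same
point `x`. -/
theorem V_add {s t : ℝ} (hs : 0 ≤ s) (ht : 0 ≤ t) :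
    V J a ha (s + t) = leftShift s ∘L V J a ha t + V J a ha s ∘L rightShift t := by
  ext1 g
  simp only [add_apply, ContinuousLinearMap.comp_apply, leftShift, rightShift]
  rcases hs.eq_or_lt with rfl | hs
  · rw [V_of_nonpos ha le_rfl, shift_zero, zero_add]
    simp
  rcases ht.eq_or_lt with rfl | ht
  · rw [V_of_nonpos ha le_rfl, neg_zero, shift_zero, add_zero]
    simp
  have hst : 0 < s + t := by linarith
  refine Lp.ext ?_
  filter_upwards [Lp.coeFn_add (shift s (V J a ha t g)) (V J a ha s (shift (-t) g)),
    coeFn_V ha hst g, coeFn_shift s (V J a ha t g), ae_shift s (coeFn_V ha ht g),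
    coeFn_V ha hs (shift (-t) g), ae_reflect ha hs (coeFn_shift (-t) g),
    ae_nonneg_halfLine] with x h1 h2 h3 h4 h5 h6 hx
  have hxs : 0 ≤ x + s := by linarith
  rw [h1, Pi.add_apply, h3.1 hxs]
  replace h4 := h4 hxs
  simp only [ha.mem_I_iff hst, ha.mem_I_iff ht, ha.mem_I_iff hs] at h2 h4 h5 h6
  by_cases hA : ∃ n ∈ J, a n - t < x + s ∧ x + s ≤ a n ∧ x + s ≤ 2 * a n - t
  · obtain ⟨n, hn, hn1, hn2, hn3⟩ := hA
    rw [h2.1 n ⟨hn, hx, by linarith, by linarith, by linarith⟩,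
      h4.1 n ⟨hn, hxs, hn1, hn2, hn3⟩]
    -- If $x\in I_m(s)$, then $m\ge n$ is impossible, as $x+s\le a_n\le a_m$. For $m<n$ the point
    -- $2a_m-x-s-t$ is negative, where the right-shifted function vanishes.
    have h7 : V J a ha s (shift (-t) g) x = 0 := by
      by_cases hB : ∃ m ∈ J, a m - s < x ∧ x ≤ a m ∧ x ≤ 2 * a m - s
      · obtain ⟨m, hm, hm1, hm2, hm3⟩ := hB
        rw [h5.1 m ⟨hm, hx, hm1, hm2, hm3⟩]
        refine (h6 m ⟨hm, hx, hm1, hm2, hm3⟩).2 ?_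
        rcases lt_trichotomy m n with h | rfl | h
        · linarith [ha.two_mul_le_of_lt hm hn h]
        · linarith
        · linarith [ha.two_mul_le_of_lt hn hm h, ha.pos n hn]
      · exact h5.2 fun m hm => hB ⟨m, hm.1, hm.2.2⟩
    rw [h7, add_zero]
    congr 1; ring
  · rw [h4.2 fun n hn => hA ⟨n, hn.1, hn.2.2⟩, zero_add]
    by_cases hB : ∃ n ∈ J, a n - s < x ∧ x ≤ a n ∧ x ≤ 2 * a n - s
    · obtain ⟨n, hn, hn1, hn2, hn3⟩ := hB
      have h7 := h6 n ⟨hn, hx, hn1, hn2, hn3⟩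
      rw [h5.1 n ⟨hn, hx, hn1, hn2, hn3⟩]
      rcases le_or_gt 0 (2 * a n - x - s + -t) with h8 | h8
      · rw [h7.1 h8, h2.1 n ⟨hn, hx, by linarith, by linarith, by linarith⟩]
        congr 1; ring
      · rw [h7.2 h8, h2.2]
        rintro m ⟨hm, -, hm1, hm2, hm3⟩
        rcases lt_trichotomy m n with h | rfl | h
        · linarith [ha.two_mul_le_of_lt hm hn h]
        · linarith
        · refine hA ⟨m, hm, ?_, ?_, ?_⟩ <;> linarith [ha.two_mul_le_of_lt hn hm h]
    · rw [h5.2 fun n hn => hB ⟨n, hn.1, hn.2.2⟩, h2.2]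
      rintro m ⟨hm, -, hm1, hm2, hm3⟩
      rcases le_or_gt (x + s) (a m) with h | h
      · exact hA ⟨m, hm, by linarith, h, by linarith⟩
      · exact hB ⟨m, hm, by linarith, hm2, by linarith⟩

end Cocycle

/-! ### The `C₀`-semigroup -/

theorem enorm_sq_eq_lintegral (f : L2) : ‖f‖ₑ ^ 2 = ∫⁻ x, ‖f x‖ₑ ^ 2 ∂halfLine := by
  rw [Lp.enorm_def, eLpNorm_eq_lintegral_rpow_enorm_toReal (by simp) (by simp)]
  simp only [ENNReal.toReal_ofNat, ENNReal.rpow_ofNat]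
  rw [← ENNReal.rpow_natCast, ← ENNReal.rpow_mul]
  norm_num

section Semigroup

variable {J : Set ℤ} {a : ℤ → ℝ} (ha : IsLacunarySeq J a)
include ha

/-- By lacunarity at most one $a_n$ lies in $(x,2x]$; it suffices that $t$ be smaller than `x` and
than the distance to that point. -/
theorem eventually_no_crossing {x : ℝ} (hx : 0 < x) :
    ∀ᶠ t in 𝓝[>] (0 : ℝ), ¬ ∃ n ∈ J, a n - t ≤ x ∧ x < a n := by
  have h0 : ∀ᶠ t in 𝓝[>] (0 : ℝ), t < x := nhdsWithin_le_nhds (Iio_mem_nhds hx)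
  by_cases h : ∃ n ∈ J, x < a n ∧ a n ≤ 2 * x
  · obtain ⟨n, hn, h1, h2⟩ := h
    have h3 : ∀ᶠ t in 𝓝[>] (0 : ℝ), t < a n - x :=
      nhdsWithin_le_nhds (Iio_mem_nhds (sub_pos.2 h1))
    filter_upwards [h0, h3] with t h4 h5
    rintro ⟨m, hm, h6, h7⟩
    rcases lt_trichotomy m n with h | rfl | h
    · linarith [ha.two_mul_le_of_lt hm hn h]
    · linarith
    · linarith [ha.two_mul_le_of_lt hn hm h]
  · filter_upwards [h0] with t h4
    rintro ⟨m, hm, h6, h7⟩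
    exact h ⟨m, hm, h7, by linarith⟩

theorem tendsto_V (g : L2) : Tendsto (fun t => V J a ha t g) (𝓝[>] 0) (𝓝 0) := by
  set S : ℝ → Set ℝ := fun t => ⋃ n ∈ J, Ico (a n - t) (a n) with hS
  have hSm : ∀ t, MeasurableSet (S t) := fun t =>
    MeasurableSet.biUnion (Set.to_countable J) fun n _ => measurableSet_Ico
  have hSi : ∀ t x, x ∈ S t ↔ ∃ n ∈ J, a n - t ≤ x ∧ x < a n := by
    intro t x; simp only [hS, mem_iUnion, mem_Ico, exists_prop]
  have hg : ∀ t, MemLp ((S t).indicator g) 2 halfLine := fun t => (Lp.memLp g).indicator (hSm t)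
  have h1 : Tendsto (fun t => ∫⁻ x, ‖(S t).indicator g x‖ₑ ^ 2 ∂halfLine) (𝓝[>] 0)
      (𝓝 (∫⁻ _, 0 ∂halfLine)) := by
    refine tendsto_lintegral_filter_of_dominated_convergence (fun x => ‖g x‖ₑ ^ 2) ?_ ?_ ?_ ?_
    · exact .of_forall fun t =>
        (((Lp.stronglyMeasurable g).indicator (hSm t)).enorm.pow_const 2)
    · refine .of_forall fun t => .of_forall fun x => ?_
      gcongr
      exact enorm_indicator_le_enorm_self _ _
    · rw [← enorm_sq_eq_lintegral]
      exact ENNReal.pow_ne_top enorm_ne_top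
    -- The origin is discarded because the $a_n$ may accumulate there.
    · have hne : ∀ᵐ x ∂halfLine, x ≠ 0 := ae_restrict_of_ae (Measure.ae_ne volume 0)
      filter_upwards [ae_nonneg_halfLine, hne] with x hx hx0
      refine Tendsto.congr' ?_ tendsto_const_nhds
      filter_upwards [eventually_no_crossing ha (lt_of_le_of_ne hx hx0.symm)] with t ht
      rw [indicator_of_notMem (by rwa [hSi])]
      simp
  rw [lintegral_zero] at h1
  have h2 : ∀ t, ‖V J a ha t g‖ₑ ^ 2 ≤ ∫⁻ x, ‖(S t).indicator g x‖ₑ ^ 2 ∂halfLine := fun t => by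
    have h3 : V J a ha t g = V J a ha t ((hg t).toLp _) := by
      refine V_congr ha ?_
      filter_upwards [(hg t).coeFn_toLp] with x hx _ hx'
      rw [hx, indicator_of_mem ((hSi t x).2 hx')]
    have h4 : ∫⁻ x, ‖(S t).indicator g x‖ₑ ^ 2 ∂halfLine = ‖(hg t).toLp _‖ₑ ^ 2 := by
      rw [enorm_sq_eq_lintegral]
      refine lintegral_congr_ae ?_
      filter_upwards [(hg t).coeFn_toLp] with x hx
      rw [hx]
    rw [h3, h4]
    gcongr
    exact enorm_le_iff_norm_le.2 (norm_V_apply_le ha t _)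
  have h3 := tendsto_of_tendsto_of_tendsto_of_le_of_le tendsto_const_nhds h1
    (fun _ => bot_le) h2
  have h4 : Tendsto (fun t => ‖V J a ha t g‖ ^ 2) (𝓝[>] 0) (𝓝 0) := by
    have h5 := (ENNReal.tendsto_toReal (by simp)).comp h3
    simpa [Function.comp_def] using h5
  rw [tendsto_zero_iff_norm_tendsto_zero]
  have h5 := h4.sqrt
  simpa using h5

theorem T_apply (t : ℝ) (h : L2Sum) : T J a ha t h =
    WithLp.toLp 2 (leftShift t h.fst + V J a ha t h.snd, rightShift t h.snd) := rfl

theorem isC0Semigroup_T : IsC0Semigroup (T J a ha) where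
  map_zero := by
    ext1 h
    rw [T_apply, V_of_nonpos ha le_rfl, leftShift, rightShift, neg_zero, shift_zero, shift_zero,
      zero_apply, add_zero]
    rfl
  map_add s t hs ht := by
    ext1 h
    rw [ContinuousLinearMap.comp_apply, T_apply, T_apply, T_apply, V_add ha hs ht]
    simp only [leftShift, rightShift, WithLp.toLp_fst, WithLp.toLp_snd, map_add]
    rw [shift_shift (Or.inl hs), shift_shift (Or.inr (by linarith))]
    rw [add_apply, ContinuousLinearMap.comp_apply, ContinuousLinearMap.comp_apply]
    rw [neg_add, add_assoc]
  tendsto_zero h := by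
    simp only [T_apply]
    have h1 : Tendsto (fun t => leftShift t h.fst + V J a ha t h.snd) (𝓝[>] 0) (𝓝 (h.fst + 0)) :=
      ((tendsto_shift h.fst).mono_left nhdsWithin_le_nhds).add (tendsto_V ha h.snd)
    have h2 : Tendsto (fun t => rightShift t h.snd) (𝓝[>] 0) (𝓝 h.snd) := by
      have h3 : Tendsto (fun t : ℝ => -t) (𝓝[>] 0) (𝓝 0) := by
        have := (continuous_neg (G := ℝ)).tendsto 0
        rw [neg_zero] at this
        exact this.mono_left nhdsWithin_le_nhds
      exact (tendsto_shift h.snd).comp h3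
    rw [add_zero] at h1
    exact ((WithLp.prodContinuousLinearEquiv 2 ℂ L2 L2).symm.continuous.tendsto (h.fst, h.snd)).comp
      (h1.prodMk_nhds h2)

theorem T_nat_mul {t : ℝ} (ht : 0 ≤ t) (n : ℕ) : T J a ha (n * t) = T J a ha t ^ n := by
  induction n with
  | zero => rw [Nat.cast_zero, zero_mul, pow_zero]; exact (isC0Semigroup_T ha).map_zero
  | succ n ih =>
    rw [Nat.cast_succ, add_one_mul, (isC0Semigroup_T ha).map_add _ _ (by positivity) ht, ih, pow_succ]
    rfl

end Semigroup

/-! ### Similarity to a contraction for `J = ℤ₋` -/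

/-- The shear `(f, g) ↦ (f + Z g, g)`. -/
def shear (Z : L2 →L[ℂ] L2) : L2Sum →L[ℂ] L2Sum :=
  ((WithLp.prodContinuousLinearEquiv 2 ℂ L2 L2).symm : L2 × L2 →L[ℂ] L2Sum) ∘L
    (((ContinuousLinearMap.id ℂ L2).coprod Z).prod (ContinuousLinearMap.snd ℂ L2 L2)) ∘L
    ((WithLp.prodContinuousLinearEquiv 2 ℂ L2 L2) : L2Sum →L[ℂ] L2 × L2)

theorem shear_apply (Z : L2 →L[ℂ] L2) (h : L2Sum) :
    shear Z h = WithLp.toLp 2 (h.fst + Z h.snd, h.snd) := rfl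

/-- The shear as an invertible operator. -/
def shearEquiv (Z : L2 →L[ℂ] L2) : L2Sum ≃L[ℂ] L2Sum :=
  ContinuousLinearEquiv.equivOfInverse (shear Z) (shear (-Z))
    (fun h => by simp only [shear_apply, WithLp.toLp_fst, WithLp.toLp_snd, neg_apply,
      add_neg_cancel_right]; rfl)
    (fun h => by simp only [shear_apply, WithLp.toLp_fst, WithLp.toLp_snd, neg_apply,
      neg_add_cancel_right]; rfl)

section Negative

variable {a : ℤ → ℝ} (ha : IsLacunarySeq (Iic 0) a)
include ha

theorem V_shift_eq_zero {s : ℝ} (t : ℝ) (hs : a 0 ≤ s) (g : L2) :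
    V (Iic 0) a ha t (shift (-s) g) = 0 := by
  rw [← map_zero (V (Iic 0) a ha t)]
  refine V_congr ha ?_
  filter_upwards [coeFn_shift (-s) g, Lp.coeFn_zero ℂ 2 halfLine] with y h1 h2 _
  rintro ⟨n, hn, -, h3⟩
  have h4 : a n ≤ a 0 := by
    rcases (show n ≤ 0 from hn).eq_or_lt with rfl | h
    · exact le_rfl
    · exact (ha.lt_of_lt hn (by simp) h).le
  rw [h1.2 (by linarith), h2, Pi.zero_apply]

/-- The formal solution is $Z=\sum_k R((k+1)t)V(t)R(kt)$. Since $L(t)R((k+1)t)=R(kt)$, the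
difference $L(t)Z-ZR(t)$ telescopes. -/
theorem exists_commutator {t : ℝ} (ht : 0 < t) : ∃ Z : L2 →L[ℂ] L2, ∀ g,
    V (Iic 0) a ha t g = leftShift t (Z g) - Z (rightShift t g) := by
  -- Once $Nt\ge a_0$, shifting right by $Nt$ moves everything beyond the last emission point, so
  -- the remainder of the telescoping sum is zero.
  obtain ⟨N, hN⟩ := exists_nat_gt (a 0 / t)
  rw [div_lt_iff₀ ht] at hN
  refine ⟨∑ k ∈ Finset.range N,
    shift (-((k + 1 : ℕ) * t)) ∘L V (Iic 0) a ha t ∘L shift (-(k * t)), fun g => ?_⟩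
  have h1 : ∀ k : ℕ, leftShift t (shift (-((k + 1 : ℕ) * t))
      (V (Iic 0) a ha t (shift (-(k * t)) g))) =
      shift (-(k * t)) (V (Iic 0) a ha t (shift (-(k * t)) g)) := fun k => by
    rw [leftShift, shift_shift (Or.inl ht.le)]
    congr 2
    push_cast; ring
  have h2 : ∀ k : ℕ, shift (-(k * t)) (rightShift t g) = shift (-((k + 1 : ℕ) * t)) g := fun k => by
    rw [rightShift, shift_shift (Or.inr (by linarith))]
    congr 2
    push_cast; ring
  simp only [sum_apply, ContinuousLinearMap.comp_apply, map_sum, h1, h2]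
  rw [← Finset.sum_sub_distrib, Finset.sum_range_sub'
    (fun k : ℕ => shift (-(k * t)) (V (Iic 0) a ha t (shift (-(k * t)) g))) N,
    V_shift_eq_zero ha t hN.le, map_zero, sub_zero, Nat.cast_zero, zero_mul, neg_zero, shift_zero,
    shift_zero]

theorem isSimilarToContraction_of_Iic {t : ℝ} (ht : 0 < t) :
    IsSimilarToContraction (T (Iic 0) a ha t) := by
  obtain ⟨Z, hZ⟩ := exists_commutator ha ht
  refine ⟨shearEquiv Z, ContinuousLinearMap.opNorm_le_bound _ zero_le_one fun h => ?_⟩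
  have h1 : conjBy (shearEquiv Z) (T (Iic 0) a ha t) h =
      WithLp.toLp 2 (leftShift t h.fst, rightShift t h.snd) := by
    change shear Z (T (Iic 0) a ha t (shear (-Z) h)) = _
    simp only [shear_apply, T_apply, hZ, WithLp.toLp_fst, WithLp.toLp_snd, map_add, neg_apply,
      map_neg]
    congr 2
    abel
  rw [h1, one_mul]
  refine abs_le_of_sq_le_sq' ?_ (norm_nonneg _) |>.2
  rw [WithLp.prod_norm_sq_eq_of_L2, WithLp.prod_norm_sq_eq_of_L2]
  exact add_le_add (pow_le_pow_left₀ (norm_nonneg _) (norm_shift_apply_le t h.fst) 2)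
    (pow_le_pow_left₀ (norm_nonneg _) (norm_shift_apply_le (-t) h.snd) 2)

end Negative

/-! ### Normalized bumps -/

theorem halfLine_Ico_ne_top (p q : ℝ) : halfLine (Ico p q) ≠ ⊤ :=
  ((Measure.restrict_apply_le _ _).trans_lt measure_Ico_lt_top).ne

/-- The normalized indicator function of `[p, p + δ)`. -/
def bump (δ p : ℝ) : L2 :=
  indicatorConstLp 2 (measurableSet_Ico : MeasurableSet (Ico p (p + δ)))
    (halfLine_Ico_ne_top _ _) (((√δ)⁻¹ : ℝ) : ℂ)

theorem coeFn_bump (δ p : ℝ) :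
    ∀ᵐ x ∂halfLine, bump δ p x = (Ico p (p + δ)).indicator (fun _ => (((√δ)⁻¹ : ℝ) : ℂ)) x :=
  indicatorConstLp_coeFn

theorem inner_bump_bump {δ p q : ℝ} (hδ : 0 < δ) (hp : 0 ≤ p) (hpq : p ≤ q) :
    inner ℂ (bump δ p) (bump δ q) = ((max (p + δ - q) 0 / δ : ℝ) : ℂ) := by
  rw [bump, bump, L2.inner_indicatorConstLp_indicatorConstLp measurableSet_Ico measurableSet_Ico
    (halfLine_Ico_ne_top _ _) (halfLine_Ico_ne_top _ _)]
  have h1 : halfLine.real (Ico p (p + δ) ∩ Ico q (q + δ)) = max (p + δ - q) 0 := by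
    have h2 : Ico p (p + δ) ∩ Ico q (q + δ) = Ico q (p + δ) := by
      ext x
      simp only [mem_inter_iff, mem_Ico]
      constructor
      · rintro ⟨h1, h2⟩; exact ⟨h2.1, h1.2⟩
      · rintro ⟨h1, h2⟩; refine ⟨⟨?_, ?_⟩, ?_, ?_⟩ <;> linarith
    have h3 : Ico q (p + δ) ∩ Ici 0 = Ico q (p + δ) :=
      inter_eq_left.2 fun x hx => (hp.trans hpq).trans hx.1
    rw [h2, measureReal_restrict_apply measurableSet_Ico, h3, measureReal_def, Real.volume_Ico,
      ENNReal.toReal_ofReal']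
  rw [h1, RCLike.inner_apply, Complex.conj_ofReal, ← Complex.ofReal_mul, ← mul_inv,
    Real.mul_self_sqrt hδ.le, Complex.real_smul, ← Complex.ofReal_mul, div_eq_mul_inv]

theorem norm_sq_bump {δ p : ℝ} (hδ : 0 < δ) (hp : 0 ≤ p) : ‖bump δ p‖ ^ 2 = 1 := by
  have h := inner_bump_bump hδ hp le_rfl
  rw [add_sub_cancel_left, max_eq_left hδ.le, div_self hδ.ne'] at h
  rw [← inner_self_eq_norm_sq (𝕜 := ℂ), h]
  simp

theorem norm_bump {δ p : ℝ} (hδ : 0 < δ) (hp : 0 ≤ p) : ‖bump δ p‖ = 1 :=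
  (pow_eq_one_iff_of_nonneg (norm_nonneg _) two_ne_zero).1 (norm_sq_bump hδ hp)

theorem inner_bump_eq_zero {δ p q : ℝ} (hδ : 0 < δ) (hp : 0 ≤ p) (hq : 0 ≤ q)
    (h : p + δ ≤ q ∨ q + δ ≤ p) : inner ℂ (bump δ p) (bump δ q) = 0 := by
  rcases h with h | h
  · rw [inner_bump_bump hδ hp (by linarith), max_eq_right (by linarith)]
    simp
  · rw [← inner_conj_symm, inner_bump_bump hδ hq (by linarith), max_eq_right (by linarith)]
    simp

theorem norm_sq_bump_sub {δ y : ℝ} (hδ : 0 < δ) (hy : 0 ≤ y) (hyδ : y ≤ δ) :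
    ‖bump δ y - bump δ 0‖ ^ 2 = 2 * y / δ := by
  rw [norm_sub_sq (𝕜 := ℂ), norm_sq_bump hδ hy, norm_sq_bump hδ le_rfl, ← inner_conj_symm,
    inner_bump_bump hδ le_rfl hy, max_eq_left (by linarith)]
  simp only [Complex.conj_ofReal, RCLike.re_to_complex, Complex.ofReal_re]
  field_simp
  ring

theorem shift_bump {δ p : ℝ} (s : ℝ) (hp : 0 ≤ p) : shift s (bump δ p) = bump δ (p - s) := by
  refine Lp.ext ?_
  filter_upwards [coeFn_shift s (bump δ p), ae_shift s (coeFn_bump δ p), coeFn_bump δ (p - s)]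
    with x h1 h2 h3
  rw [h3]
  have h4 : x ∈ Ico (p - s) (p - s + δ) ↔ x + s ∈ Ico p (p + δ) := by
    simp only [mem_Ico]
    constructor <;> rintro ⟨h5, h6⟩ <;> constructor <;> linarith
  rcases le_or_gt 0 (x + s) with h5 | h5
  · rw [h1.1 h5, h2 h5]
    simp only [indicator_apply, h4]
  · rw [h1.2 h5, indicator_of_notMem]
    rw [h4]
    exact fun h => absurd h.1 (by linarith)

/-! ### Reflection of bumps at the points $a_n$ -/

section Reflection

variable {J : Set ℤ} {a : ℤ → ℝ} (ha : IsLacunarySeq J a)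
include ha

/-- The reflection in $a_k$ reverses the bump, sending its left end to the right end of its image;
hence the extra $\delta$ in `hs`. The mismatch of half-open intervals is a null set, and lacunarity
keeps the other $a_n$ from contributing. -/
theorem V_bump {δ x y s : ℝ} {k : ℤ} (hk : k ∈ J) (hδ : 0 < δ) (hx : 0 ≤ x) (hy : 0 ≤ y)
    (hs : x + y + s + δ = 2 * a k) (hxk : x + δ ≤ a k) (hyk : y + δ ≤ a k) :
    V J a ha s (bump δ y) = bump δ x := by
  have hs0 : 0 < s := by linarith
  refine Lp.ext ?_
  have hne : ∀ c : ℝ, ∀ᵐ z ∂halfLine, z ≠ c := fun c => ae_restrict_of_ae (Measure.ae_ne volume c)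
  filter_upwards [coeFn_V ha hs0 (bump δ y), ae_reflect ha hs0 (coeFn_bump δ y), coeFn_bump δ x,
    hne x, hne (x + δ), hne 0, ae_nonneg_halfLine] with z h1 h2 h3 h4 h5 h0 h6
  rw [h3]
  by_cases hz : ∃ n, z ∈ I J a s n
  · obtain ⟨n, hn⟩ := hz
    rw [h1.1 n hn, h2 n hn]
    rw [ha.mem_I_iff hs0] at hn
    obtain ⟨hn, -, hn1, hn2, hn3⟩ := hn
    rcases lt_trichotomy n k with h | rfl | h
    · have h7 := ha.two_mul_le_of_lt hn hk h
      rw [indicator_of_notMem, indicator_of_notMem] <;> simp only [mem_Ico, not_and, not_lt]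
      · exact fun h => absurd (le_antisymm (by linarith) h) h4
      · exact fun h => absurd (le_antisymm (by linarith) h6) h0
    · have h7 : 2 * a n - z - s ∈ Ico y (y + δ) ↔ z ∈ Ico x (x + δ) := by
        simp only [mem_Ico]
        constructor
        · rintro ⟨h7, h8⟩
          refine ⟨by linarith, lt_of_le_of_ne (by linarith) h5⟩
        · rintro ⟨h7, h8⟩
          have := lt_of_le_of_ne h7 h4.symm
          refine ⟨by linarith, by linarith⟩
      simp only [indicator_apply, h7]
    · have h7 := ha.two_mul_le_of_lt hk hn h
      rw [indicator_of_notMem, indicator_of_notMem] <;> simp only [mem_Ico, not_and, not_lt]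
      · intro; linarith
      · intro; linarith
  · rw [h1.2 (not_exists.1 hz), indicator_of_notMem]
    rintro ⟨h7, h8⟩
    have := lt_of_le_of_ne h7 h4.symm
    exact hz ⟨k, (ha.mem_I_iff hs0).2 ⟨hk, h6, by linarith, by linarith, by linarith⟩⟩

/-- The left-shifted bump, with coefficient `μ`, and the copy emitted by the second component land
on the same interval, so their amplitudes add up to `1 + μ`. -/
theorem T_reflection {δ x y s : ℝ} {k : ℤ} (hk : k ∈ J) (hδ : 0 < δ) (hx : 0 ≤ x) (hy : 0 ≤ y)
    (hs : x + y + s + δ = 2 * a k) (hxk : x + δ ≤ a k) (hyk : y + δ ≤ a k) (μ : ℝ) :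
    T J a ha s ((μ : ℂ) • WithLp.toLp 2 (bump δ (x + s), 0) + WithLp.toLp 2 (0, bump δ y)) =
      ((1 + μ : ℝ) : ℂ) • WithLp.toLp 2 (bump δ x, 0) + WithLp.toLp 2 (0, bump δ (y + s)) := by
  have h1 : ∀ c : ℂ, ∀ f g : L2, c • WithLp.toLp 2 (f, (0 : L2)) + WithLp.toLp 2 ((0 : L2), g) =
      WithLp.toLp 2 (c • f, g) := fun c f g => by
    rw [← WithLp.toLp_smul, ← WithLp.toLp_add]
    simp
  rw [h1, h1, T_apply]
  change WithLp.toLp 2 (shift s ((μ : ℂ) • bump δ (x + s)) + V J a ha s (bump δ y),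
    shift (-s) (bump δ y)) = _
  rw [map_smul, shift_bump s (by linarith), shift_bump (-s) hy,
    V_bump ha hk hδ hx hy hs hxk hyk, add_sub_cancel_right, sub_neg_eq_add]
  congr 2
  push_cast
  rw [add_smul, one_smul, add_comm]

theorem T_shift_bump {δ p s : ℝ} (hp : 0 ≤ p) :
    T J a ha s (WithLp.toLp 2 (bump δ p, 0)) = WithLp.toLp 2 (bump δ (p - s), 0) := by
  rw [T_apply]
  change WithLp.toLp 2 (shift s (bump δ p) + V J a ha s 0, shift (-s) 0) = _
  rw [shift_bump s hp, map_zero, map_zero, add_zero]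

/-- For each equivalent Hilbert norm there are `N` and `ε` such that the norm is not nonincreasing,
up to the factor `1 + ε`, under the reflections at `N + 1` consecutive points `a_n`. -/
theorem exists_no_contractive_norm (K : ℝ) (hK : 1 ≤ K) : ∃ (N : ℕ) (ε : ℝ), 0 < ε ∧
    ∀ (U : L2Sum →L[ℂ] L2Sum), (∀ h, ‖U h‖ ≤ K * ‖h‖) → (∀ h, ‖h‖ ≤ K * ‖U h‖) →
    ∀ (m : ℤ) (δ : ℝ) (b y : ℕ → ℝ), 0 < δ → (∀ i ≤ N, m + i ∈ J) →
    (∀ i ≤ N, 0 ≤ b i ∧ b i ≤ a (m + i)) → (∀ i ≤ N, δ ≤ a (m + i)) →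
    (∀ i ≤ N, 0 ≤ y i ∧ y i ≤ δ) → (∀ i ≤ N, 2 * y i / δ ≤ ε ^ 2) →
    (∀ k l, k < l → l ≤ N → 2 * a (m + k) - δ - y k ≤ b l) →
    (∀ j k, j < k → k ≤ N → ∀ h, ‖U (T J a ha (2 * a (m + k) - δ - y k - b j) h)‖ ^ 2 ≤
      (1 + ε) * ‖U h‖ ^ 2) →
    (∀ k l, k < l → l ≤ N → ∀ h, ‖U (T J a ha (b l - (2 * a (m + k) - δ - y k)) h)‖ ^ 2 ≤
      (1 + ε) * ‖U h‖ ^ 2) → False := by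
  obtain ⟨N, ε, hε, hmain⟩ := exists_no_reflection_system (H := L2Sum) K hK
  refine ⟨N, ε, hε, ?_⟩
  intro U hU hU' m δ b y hδ hm hb hδa hy hyε hbl hT hT'
  have hlac : ∀ j k : ℕ, j < k → k ≤ N → 2 * a (m + j) ≤ a (m + k) := fun j k hjk hk =>
    ha.two_mul_le_of_lt (hm j (by omega)) (hm k hk) (by omega)
  have he0 : ∀ k ≤ N, 0 ≤ 2 * a (m + k) - δ - y k := fun k hk => by
    linarith [hδa k hk, (hy k hk).2]
  have hn1 : ∀ p, 0 ≤ p → ‖(WithLp.toLp 2 (bump δ p, 0) : L2Sum)‖ = 1 := fun p hp => by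
    rw [WithLp.prod_norm_eq_of_L2]
    simp [norm_bump hδ hp]
  have hn2 : ∀ p, 0 ≤ p → ‖(WithLp.toLp 2 (0, bump δ p) : L2Sum)‖ = 1 := fun p hp => by
    rw [WithLp.prod_norm_eq_of_L2]
    simp [norm_bump hδ hp]
  -- The position $2a_{m+k}-\delta-y_k$ of `E k` is the one from which a left shift to $b_j$ takes
  -- exactly the time in which the bump at $y_k$ is reflected to $b_j$. The second component has
  -- then moved to $2a_{m+k}-\delta-b_j$.
  refine hmain U hU hU' (fun j => WithLp.toLp 2 (bump δ (b j), 0))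
    (fun k => WithLp.toLp 2 (bump δ (2 * a (m + k) - δ - y k), 0))
    (fun k => WithLp.toLp 2 (0, bump δ (y k))) (WithLp.toLp 2 (0, bump δ 0))
    (fun j k => WithLp.toLp 2 (0, bump δ (2 * a (m + k) - δ - b j)))
    (fun j hj => hn1 _ (hb j hj).1) (fun k hk => hn1 _ (he0 k hk)) (hn2 _ le_rfl)
    ?_ ?_ ?_ ?_ ?_ ?_
  · intro k hk l hl hkl
    rw [WithLp.prod_inner_apply]
    simp only [inner_zero_right, add_zero]
    have hy1 := hy k hk
    have hy2 := hy l hl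
    refine inner_bump_eq_zero hδ (he0 k hk) (he0 l hl) ?_
    rcases lt_or_gt_of_ne hkl with h | h
    · left; linarith [hlac k l h hl, hδa k hk]
    · right; linarith [hlac l k h hk, hδa l hl]
  · intro k hk
    have h1 : (WithLp.toLp 2 (0, bump δ (y k)) : L2Sum) - WithLp.toLp 2 (0, bump δ 0) =
        WithLp.toLp 2 (0, bump δ (y k) - bump δ 0) := by
      rw [← WithLp.toLp_sub]; simp
    have h2 := norm_sq_bump_sub hδ (hy k hk).1 (hy k hk).2
    rw [h1]
    refine abs_le_of_sq_le_sq' ?_ hε.le |>.2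
    rw [WithLp.prod_norm_sq_eq_of_L2]
    simp only [WithLp.toLp_fst, WithLp.toLp_snd, norm_zero]
    rw [h2]
    linarith [hyε k hk]
  · intro j k hjk hk
    exact hn2 _ (by linarith [(hb j (by omega)).2, hlac j k hjk hk, hδa j (by omega), hδa k hk])
  · intro j k l hjk hk hjl hl hkl
    rw [WithLp.prod_inner_apply]
    simp only [inner_zero_right, zero_add]
    have h1 := hb j (by omega)
    have h2 := hlac j k hjk hk
    have h3 := hlac j l hjl hl
    have h4 := hδa j (by omega)
    refine inner_bump_eq_zero hδ (by linarith) (by linarith) ?_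
    rcases lt_or_gt_of_ne hkl with h | h
    · left; linarith [hlac k l h hl, hδa k hk]
    · right; linarith [hlac l k h hk, hδa l hl]
  · intro j k hjk hk μ
    have h1 := hb j (by omega)
    have h2 := hlac j k hjk hk
    have h4 := hδa j (by omega)
    have h5 := T_reflection ha (hm k hk) hδ h1.1 (hy k hk).1
      (s := 2 * a (m + k) - δ - y k - b j) (by ring) (by linarith)
      (by linarith [(hy k hk).2]) μ
    rw [show b j + (2 * a (m + k) - δ - y k - b j) = 2 * a (m + k) - δ - y k by ring,
      show y k + (2 * a (m + k) - δ - y k - b j) = 2 * a (m + k) - δ - b j by ring] at h5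
    rw [← h5]
    exact hT j k hjk hk _
  · intro k l hkl hl
    have h1 := hT' k l hkl hl (WithLp.toLp 2 (bump δ (b l), 0))
    rwa [T_shift_bump ha (hb l hl).1, sub_sub_cancel] at h1

end Reflection

/-! ### Failure of similarity -/

section Conj

variable {H : Type*} [NormedAddCommGroup H] [InnerProductSpace ℂ H]

theorem norm_apply_le_of_norm_conjBy_le {R : H ≃L[ℂ] H} {T : H →L[ℂ] H} {c : ℝ}
    (h : ‖conjBy R T‖ ≤ c) (x : H) : ‖R (T x)‖ ≤ c * ‖R x‖ := by
  have h1 := (conjBy R T).le_of_opNorm_le h (R x)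
  simpa [conjBy] using h1

theorem exists_equivalence_constant (R : H ≃L[ℂ] H) : ∃ K : ℝ, 1 ≤ K ∧
    (∀ h, ‖(R : H →L[ℂ] H) h‖ ≤ K * ‖h‖) ∧ ∀ h, ‖h‖ ≤ K * ‖(R : H →L[ℂ] H) h‖ := by
  refine ⟨max 1 (max ‖(R : H →L[ℂ] H)‖ ‖(R.symm : H →L[ℂ] H)‖), le_max_left _ _, fun h => ?_,
    fun h => ?_⟩
  · exact (R : H →L[ℂ] H).le_of_opNorm_le ((le_max_left _ _).trans (le_max_right _ _)) h
  · have := (R.symm : H →L[ℂ] H).le_of_opNorm_le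
      ((le_max_right ‖(R : H →L[ℂ] H)‖ _).trans (le_max_right 1 _)) (R h)
    simpa using this

end Conj

section Failure

variable {J : Set ℤ} {a : ℤ → ℝ} (ha : IsLacunarySeq J a)
include ha

theorem le_of_le_of_mem {m n : ℤ} (hm : m ∈ J) (hn : n ∈ J) (hmn : m ≤ n) : a m ≤ a n := by
  rcases hmn.eq_or_lt with rfl | h
  · exact le_rfl
  · exact (ha.lt_of_lt hm hn h).le

theorem not_isSimilarToContraction (hJ : ∀ n : ℤ, 0 ≤ n → n ∈ J) {t : ℝ} (ht : 0 < t) :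
    ¬ IsSimilarToContraction (T J a ha t) := by
  rintro ⟨R, hR⟩
  obtain ⟨K, hK, hU, hU'⟩ := exists_equivalence_constant R
  obtain ⟨N, ε, hε, hmain⟩ := exists_no_contractive_norm ha K hK
  have hpow : ∀ (n : ℕ) h, ‖R ((T J a ha t ^ n) h)‖ ≤ ‖R h‖ := by
    intro n
    induction n with
    | zero => intro h; simp
    | succ n ih =>
      intro h
      rw [pow_succ', mul_apply_eq_comp]
      have := norm_apply_le_of_norm_conjBy_le hR ((T J a ha t ^ n) h)
      rw [one_mul] at this
      exact this.trans (ih h)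
  -- A contraction at the single time `t` controls only integer multiples of `t`, so every time used
  -- below has to be one.
  have hint : ∀ s : ℝ, 0 ≤ s → (∃ z : ℤ, s = t * z) → ∀ h,
      ‖(R : L2Sum →L[ℂ] L2Sum) (T J a ha s h)‖ ^ 2 ≤
        (1 + ε) * ‖(R : L2Sum →L[ℂ] L2Sum) h‖ ^ 2 := by
    rintro s hs ⟨z, rfl⟩ h
    have hz : 0 ≤ z := by
      have := nonneg_of_mul_nonneg_right hs ht
      exact_mod_cast this
    lift z to ℕ using hz
    rw [Int.cast_natCast, mul_comm, T_nat_mul ha ht.le]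
    have h1 : ‖(R : L2Sum →L[ℂ] L2Sum) ((T J a ha t ^ z) h)‖ ^ 2 ≤
        ‖(R : L2Sum →L[ℂ] L2Sum) h‖ ^ 2 := pow_le_pow_left₀ (norm_nonneg _) (hpow z h) 2
    nlinarith [sq_nonneg ‖(R : L2Sum →L[ℂ] L2Sum) h‖]
  -- Bumps of width $qt$ with $q\ge2/\varepsilon^2$ move by at most $\varepsilon$ in norm under a
  -- displacement $y\le t$, since the squared change is $2y/(qt)$.
  obtain ⟨q, hq⟩ := exists_nat_ge (max 1 (2 / ε ^ 2))
  have hq1 : (1 : ℝ) ≤ q := (le_max_left _ _).trans hq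
  have hq2 := (le_max_right _ _).trans hq
  rw [div_le_iff₀ (by positivity)] at hq2
  have hδ : 0 < q * t := by positivity
  obtain ⟨m, hm0, hm⟩ := ha.exists_gt hJ (q * t)
  have hmJ : ∀ i : ℕ, m + i ∈ J := fun i => hJ _ (by omega)
  have hδa : ∀ i : ℕ, q * t ≤ a (m + i) := fun i =>
    hm.le.trans (le_of_le_of_mem ha (hJ m hm0) (hmJ i) (by omega))
  have hfl : ∀ c : ℝ, t * ⌊c / t⌋ ≤ c ∧ c - t < t * ⌊c / t⌋ := fun c => by
    have h1 := Int.floor_le (c / t)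
    have h2 := Int.lt_floor_add_one (c / t)
    rw [le_div_iff₀ ht] at h1
    rw [div_lt_iff₀ ht] at h2
    constructor <;> linarith
  -- The target `b` is rounded down to the grid $t\mathbb Z$, and `y` absorbs the remainder of $2a$
  -- modulo `t`. All time differences thus become multiples of `t`.
  set b : ℕ → ℝ := fun i => t * ⌊a (m + i) / t⌋ with hb
  set y : ℕ → ℝ := fun i => 2 * a (m + i) - t * ⌊2 * a (m + i) / t⌋ with hy
  have hb1 : ∀ i, 0 ≤ b i ∧ b i ≤ a (m + i) := fun i =>
    ⟨mul_nonneg ht.le (by exact_mod_cast Int.floor_nonneg.2 (div_nonneg (ha.pos _ (hmJ i)).le ht.le)),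
      (hfl _).1⟩
  have hy1 : ∀ i, 0 ≤ y i ∧ y i ≤ t := fun i => by
    have := hfl (2 * a (m + i))
    constructor <;> simp only [hy] <;> linarith
  have htδ : t ≤ q * t := by nlinarith
  have hlac : ∀ j k : ℕ, j < k → 2 * a (m + j) ≤ a (m + k) := fun j k hjk =>
    ha.two_mul_le_of_lt (hmJ j) (hmJ k) (by omega)
  have hbl : ∀ k l : ℕ, k < l → 2 * a (m + k) - q * t - y k ≤ b l := fun k l hkl => by
    have h1 : ⌊2 * a (m + k) / t⌋ ≤ ⌊a (m + l) / t⌋ :=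
      Int.floor_le_floor (div_le_div_of_nonneg_right (hlac k l hkl) ht.le)
    have h2 : (⌊2 * a (m + k) / t⌋ : ℝ) ≤ ⌊a (m + l) / t⌋ := by exact_mod_cast h1
    have h3 := mul_le_mul_of_nonneg_left h2 ht.le
    simp only [hy, hb]
    linarith
  refine hmain R hU hU' m (q * t) b y hδ (fun i _ => hmJ i) (fun i _ => hb1 i) (fun i _ => hδa i)
    (fun i _ => ⟨(hy1 i).1, (hy1 i).2.trans htδ⟩) (fun i _ => ?_) (fun k l hkl _ => hbl k l hkl)
    (fun j k hjk _ => hint _ ?_ ?_) (fun k l hkl _ => hint _ (sub_nonneg.2 (hbl k l hkl)) ?_)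
  · rw [div_le_iff₀ hδ]
    have h1 := mul_le_mul_of_nonneg_right hq2 ht.le
    linarith [(hy1 i).2]
  · linarith [hlac j k hjk, (hb1 j).2, (hy1 k).2, hδa k, hδa j]
  · refine ⟨⌊2 * a (m + k) / t⌋ - q - ⌊a (m + j) / t⌋, ?_⟩
    simp only [hy, hb]
    push_cast
    ring
  · refine ⟨⌊a (m + l) / t⌋ - (⌊2 * a (m + k) / t⌋ - q), ?_⟩
    simp only [hy, hb]
    push_cast
    ring

theorem not_isSQC (hJ : ∀ n : ℤ, n ≤ 0 → n ∈ J) : ¬ IsSQC (T J a ha) := by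
  rintro ⟨-, R, -, lam, hR⟩
  obtain ⟨K, hK, hU, hU'⟩ := exists_equivalence_constant R
  obtain ⟨N, ε, hε, hmain⟩ := exists_no_contractive_norm ha K hK
  have hlog : 0 < Real.log (1 + ε) := Real.log_pos (by linarith)
  -- All times below are at most $2a_M$, and $4|\lambda|a_M\le\log(1+\varepsilon)$ gives
  -- $e^{2\lambda s}\le1+\varepsilon$ for them.
  obtain ⟨M, hM0, hM⟩ := ha.exists_lt hJ (t := Real.log (1 + ε) / (4 * (|lam| + 1)))
    (by positivity)
  rw [lt_div_iff₀ (by positivity)] at hM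
  have hMJ := hJ M hM0
  have haM := ha.pos M hMJ
  have hcon : ∀ s : ℝ, 0 ≤ s → s ≤ 2 * a M → ∀ h,
      ‖(R : L2Sum →L[ℂ] L2Sum) (T J a ha s h)‖ ^ 2 ≤
        (1 + ε) * ‖(R : L2Sum →L[ℂ] L2Sum) h‖ ^ 2 := by
    intro s hs hs' h
    have h1 : Real.exp (lam * s) ^ 2 ≤ 1 + ε := by
      rw [← Real.exp_nat_mul, ← Real.le_log_iff_exp_le (by linarith)]
      push_cast
      have h2 : lam * s ≤ |lam| * (2 * a M) :=
        (mul_le_mul_of_nonneg_right (le_abs_self lam) hs).trans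
          (mul_le_mul_of_nonneg_left hs' (abs_nonneg lam))
      linarith
    calc ‖(R : L2Sum →L[ℂ] L2Sum) (T J a ha s h)‖ ^ 2 ≤ (Real.exp (lam * s) * ‖R h‖) ^ 2 :=
          pow_le_pow_left₀ (norm_nonneg _) (norm_apply_le_of_norm_conjBy_le (hR s hs) h) 2
      _ = Real.exp (lam * s) ^ 2 * ‖R h‖ ^ 2 := mul_pow _ _ _
      _ ≤ (1 + ε) * ‖R h‖ ^ 2 := mul_le_mul_of_nonneg_right h1 (sq_nonneg _)
  -- The `N + 1` points used end at $a_M$. All times being available, no rounding is needed: `y =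
  -- 0`, and the smallest point serves as the bump width.
  set m : ℤ := M - N with hm
  have hmJ : ∀ i ≤ N, m + (i : ℕ) ∈ J := fun i hi => hJ _ (by omega)
  have hmJ0 : m ∈ J := hJ _ (by omega)
  have haM' : ∀ i : ℕ, i ≤ N → a (m + i) ≤ a M := fun i hi =>
    le_of_le_of_mem ha (hmJ i hi) hMJ (by omega)
  have ham : ∀ i : ℕ, i ≤ N → a m ≤ a (m + i) := fun i hi =>
    le_of_le_of_mem ha hmJ0 (hmJ i hi) (by omega)
  have hpos := ha.pos m hmJ0
  have hlac : ∀ j k : ℕ, j < k → k ≤ N → 2 * a (m + j) ≤ a (m + k) := fun j k hjk hk =>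
    ha.two_mul_le_of_lt (hmJ j (by omega)) (hmJ k hk) (by omega)
  refine hmain R hU hU' m (a m) (fun i => a (m + i)) (fun _ => 0) hpos hmJ
    (fun i hi => ⟨(ha.pos _ (hmJ i hi)).le, le_rfl⟩) ham (fun _ _ => ⟨le_rfl, hpos.le⟩)
    (fun _ _ => ?_) (fun k l hkl hl => ?_) (fun j k hjk hk => hcon _ ?_ ?_)
    (fun k l hkl hl => hcon _ ?_ ?_)
  · rw [mul_zero, zero_div]; positivity
  · linarith [hlac k l hkl hl]
  · linarith [hlac j k hjk hk, ham j (by omega), ham k hk]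
  · linarith [haM' k hk, ham j (by omega)]
  · linarith [hlac k l hkl hl]
  · linarith [haM' l hl, ham k (by omega)]

end Failure

/-! ### Weights for `J = ℤ₊` -/

/-- The function that jumps from `1` to `1 + c` at `0` and returns to `1` with slope `-c q`. -/
def tent (c q r : ℝ) : ℝ := if 0 < r then max 1 (1 + c * (1 - q * r)) else 1

theorem one_le_tent (c q r : ℝ) : 1 ≤ tent c q r := by
  unfold tent; split_ifs
  · exact le_max_left _ _
  · exact le_rfl

theorem tent_le {c q : ℝ} (hc : 0 ≤ c) (hq : 0 ≤ q) (r : ℝ) : tent c q r ≤ 1 + c := by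
  unfold tent; split_ifs with h
  · refine max_le (by linarith) ?_
    have := mul_nonneg hc (mul_nonneg hq h.le)
    linarith
  · linarith

/-- Moving right, a tent jumps only upward and otherwise descends with slope at most $cq$. As its
values are at least $1$, this additive loss is absorbed by a factor $1+cqt$. -/
theorem tent_le_mul {c q t E : ℝ} (hc : 0 ≤ c) (hq : 0 ≤ q) (ht : 0 ≤ t)
    (hE : 1 + c * (q * t) ≤ E) (r : ℝ) : tent c q r ≤ E * tent c q (r + t) := by
  have h1 := one_le_tent c q (r + t)
  have h2 : 0 ≤ c * (q * t) := by positivity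
  have h3 : (1 + c * (q * t)) * tent c q (r + t) ≤ E * tent c q (r + t) :=
    mul_le_mul_of_nonneg_right hE (by linarith)
  refine le_trans ?_ h3
  have h4 : c * (q * t) * 1 ≤ c * (q * t) * tent c q (r + t) := mul_le_mul_of_nonneg_left h1 h2
  rcases le_or_gt r 0 with h | h
  · rw [show tent c q r = 1 from if_neg (not_lt.2 h)]
    linarith
  · have h5 : tent c q (r + t) = max 1 (1 + c * (1 - q * (r + t))) := if_pos (by linarith)
    have h6 : 1 + c * (1 - q * (r + t)) ≤ tent c q (r + t) := h5 ▸ le_max_right _ _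
    rw [show tent c q r = max 1 (1 + c * (1 - q * r)) from if_pos h]
    refine max_le (by linarith) (by linarith)

/-- A tent returns to $1$ at distance $\ell=1/q$ from its base, so in the last stretch of length `t`
at most $cqt$ of its height is left. -/
theorem tent_le_of_far {c q ℓ t r : ℝ} (hc : 0 ≤ c) (hq : 0 ≤ q) (hqℓ : q * ℓ = 1) (ht : 0 ≤ t)
    (h : r ≤ 0 ∨ ℓ - t ≤ r) : tent c q r ≤ 1 + c * (q * t) := by
  have h2 : 0 ≤ c * (q * t) := by positivity
  unfold tent; split_ifs with h1
  · rcases h with h | h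
    · linarith
    · have h3 := mul_le_mul_of_nonneg_left (mul_le_mul_of_nonneg_left h hq) hc
      refine max_le (by linarith) ?_
      linarith [show c * (q * (ℓ - t)) = c - c * (q * t) by rw [mul_sub, hqℓ]; ring]
  · linarith

theorem le_tent {c q r t : ℝ} (hc : 0 ≤ c) (hq : 0 ≤ q) (hr : 0 < r) (hrt : r ≤ t) :
    1 + c * (1 - q * t) ≤ tent c q r := by
  rw [tent, if_pos hr]
  refine le_trans ?_ (le_max_right _ _)
  have := mul_le_mul_of_nonneg_left (mul_le_mul_of_nonneg_left hrt hq) hc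
  linarith

theorem measurable_tent (c q : ℝ) : Measurable (tent c q) := by
  unfold tent
  exact Measurable.ite measurableSet_Ioi (by fun_prop) measurable_const

/-- The supremum of tents based at the points `a_n`, for `σ = 1` to the right of these points, and
for `σ = -1` to the left. -/
def weight (a : ℤ → ℝ) (c q σ x : ℝ) : ℝ := ⨆ n : ℕ, tent c q (σ * (x - a n))

section Weight

variable (a : ℤ → ℝ) {c q : ℝ} (σ : ℝ)

theorem bddAbove_tent (hc : 0 ≤ c) (hq : 0 ≤ q) (x : ℝ) :
    BddAbove (range fun n : ℕ => tent c q (σ * (x - a n))) :=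
  ⟨1 + c, by rintro _ ⟨n, rfl⟩; exact tent_le hc hq _⟩

theorem tent_le_weight (hc : 0 ≤ c) (hq : 0 ≤ q) (x : ℝ) (n : ℕ) :
    tent c q (σ * (x - a n)) ≤ weight a c q σ x :=
  le_ciSup (bddAbove_tent a σ hc hq x) n

theorem one_le_weight (hc : 0 ≤ c) (hq : 0 ≤ q) (x : ℝ) : 1 ≤ weight a c q σ x :=
  (one_le_tent _ _ _).trans (tent_le_weight a σ hc hq x 0)

theorem weight_le (hc : 0 ≤ c) (hq : 0 ≤ q) (x : ℝ) : weight a c q σ x ≤ 1 + c :=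
  ciSup_le fun _ => tent_le hc hq _

theorem measurable_weight (c q : ℝ) : Measurable (weight a c q σ) :=
  Measurable.iSup fun _ => (measurable_tent c q).comp ((measurable_id.sub_const _).const_mul _)

variable {σ}

/-- The hypothesis `hz` covers both directions of motion: $z=x+t$ for $\sigma=1$ and $z=x-t$ for
$\sigma=-1$. In both, mass moves from `z` to `x`. -/
theorem weight_le_mul {x z t E : ℝ} (hc : 0 ≤ c) (hq : 0 ≤ q) (ht : 0 ≤ t)
    (hE : 1 + c * (q * t) ≤ E) (hz : ∀ p, σ * (x - p) + t = σ * (z - p)) :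
    weight a c q σ x ≤ E * weight a c q σ z := by
  have hE0 : 0 ≤ E := le_trans (by positivity) hE
  refine ciSup_le fun n => (tent_le_mul hc hq ht hE _).trans ?_
  rw [hz]
  exact mul_le_mul_of_nonneg_left (tent_le_weight a σ hc hq z n) hE0

variable {a} (ha : IsLacunarySeq (Ici 0) a)
include ha

theorem add_le_of_lt {m n : ℕ} (h : m < n) : a m + a 0 ≤ a n := by
  have h1 := ha.two_mul_le_of_lt (m := m) (n := n) (by simp) (by simp) (by omega)
  have h2 := le_of_le_of_mem ha (m := 0) (n := m) (by simp) (by simp) (by omega)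
  linarith

/-- First-component mass crossing $a_n$ leftwards goes from a point just past a jump, with weight
near $2$, to one with weight near $1$. The gaps are at least $a_0=1/q$, so no other tent spoils
this. The gained factor $2$ pays for $|z+w|^2\le2|z|^2+2|w|^2$ when an emitted copy is added. -/
theorem two_mul_weight_le {x t E : ℝ} (hq : q * a 0 = 1) (hq0 : 0 ≤ q)
    (hE : 1 + 8 * (q * t) ≤ E) (n : ℕ) (h1 : x ≤ a n) (h2 : a n < x + t) :
    2 * weight a 1 q 1 x ≤ E * weight a 1 q 1 (x + t) := by
  have ht : 0 ≤ t := by linarith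
  have hu : weight a 1 q 1 x ≤ 1 + 1 * (q * t) := by
    refine ciSup_le fun m => tent_le_of_far zero_le_one hq0 hq ht ?_
    rw [one_mul]
    rcases lt_or_ge m n with h | h
    · right; linarith [add_le_of_lt ha h]
    · left
      linarith [le_of_le_of_mem ha (m := n) (n := m) (by simp) (by simp) (by omega)]
  have hv1 := one_le_weight a 1 zero_le_one hq0 (x + t)
  have hv2 := (le_tent (r := 1 * (x + t - a n)) (t := t) zero_le_one hq0 (by linarith)
    (by linarith)).trans (tent_le_weight a 1 zero_le_one hq0 (x + t) n)
  have hτ : 0 ≤ q * t := by positivity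
  generalize weight a 1 q 1 (x + t) = v at *
  generalize q * t = τ at *
  have h3 : (1 + 8 * τ) * v ≤ E * v := mul_le_mul_of_nonneg_right hE (by linarith)
  rcases le_or_gt τ 1 with h | h
  · have := mul_le_mul_of_nonneg_left hv2 (show 0 ≤ 1 + 8 * τ by linarith)
    nlinarith
  · have := mul_le_mul_of_nonneg_left hv1 (show 0 ≤ 1 + 8 * τ by linarith)
    linarith

/-- The mirror image: second-component mass crossing $a_n$ rightwards drops from weight near $5$ to
near $1$. The surplus $4$ pays for the emitted copy. -/
theorem weight_add_four_le {y t E : ℝ} (hq : q * a 0 = 1) (hq0 : 0 ≤ q)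
    (hE : 1 + 8 * (q * t) ≤ E) (n : ℕ) (h1 : y < a n) (h2 : a n - t ≤ y) :
    weight a 4 q (-1) (y + t) + 4 ≤ E * weight a 4 q (-1) y := by
  have ht : 0 ≤ t := by linarith
  have hu : weight a 4 q (-1) (y + t) ≤ 1 + 4 * (q * t) := by
    refine ciSup_le fun m => tent_le_of_far (by norm_num) hq0 hq ht ?_
    rcases lt_or_ge n m with h | h
    · right; linarith [add_le_of_lt ha h]
    · left
      linarith [le_of_le_of_mem ha (m := m) (n := n) (by simp) (by simp) (by omega)]
  have hv1 := one_le_weight a (c := 4) (-1) (by norm_num) hq0 y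
  have hv2 := (le_tent (c := 4) (r := -1 * (y - a n)) (t := t) (by norm_num) hq0 (by linarith)
    (by linarith)).trans (tent_le_weight a (-1) (by norm_num) hq0 y n)
  have hτ : 0 ≤ q * t := by positivity
  generalize weight a 4 q (-1) y = v at *
  generalize q * t = τ at *
  have h3 : (1 + 8 * τ) * v ≤ E * v := mul_le_mul_of_nonneg_right hE (by linarith)
  -- The bound to reach is $5+4\tau$. For $\tau\le1$ use $(1+8\tau)(5-4\tau)\ge5+4\tau$; for
  -- $\tau>1$ already $1+8\tau\ge5+4\tau$. Both are equalities at $\tau=1$, which dictates the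
  -- constant $8$.
  rcases le_or_gt τ 1 with h | h
  · have := mul_le_mul_of_nonneg_left hv2 (show 0 ≤ 1 + 8 * τ by linarith)
    nlinarith
  · have := mul_le_mul_of_nonneg_left hv1 (show 0 ≤ 1 + 8 * τ by linarith)
    linarith

end Weight

/-! ### Multiplication operators -/

theorem memLp_mul {m : ℝ → ℝ} (hm : Measurable m) {C : ℝ} (hC : ∀ x, |m x| ≤ C) (f : L2) :
    MemLp (fun x => (m x : ℂ) * f x) 2 halfLine :=
  (Lp.memLp f).of_le_mul
    ((Complex.measurable_ofReal.comp hm).aestronglyMeasurable.mul (Lp.aestronglyMeasurable f))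
    (c := C) (.of_forall fun x => by
      rw [norm_mul, Complex.norm_real]
      exact mul_le_mul_of_nonneg_right (hC x) (norm_nonneg _))

/-- Multiplication by a bounded measurable function on `L²(ℝ₊)`. -/
def mulOp (m : ℝ → ℝ) (hm : Measurable m) (C : ℝ) (hC : ∀ x, |m x| ≤ C) : L2 →L[ℂ] L2 :=
  LinearMap.mkContinuous
    { toFun := fun f => (memLp_mul hm hC f).toLp _
      map_add' := by
        intro f g
        rw [← MemLp.toLp_add]
        refine MemLp.toLp_congr _ _ ?_
        filter_upwards [Lp.coeFn_add f g] with x hx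
        rw [hx, Pi.add_apply, Pi.add_apply, mul_add]
      map_smul' := by
        intro c f
        rw [RingHom.id_apply, ← MemLp.toLp_const_smul]
        refine MemLp.toLp_congr _ _ ?_
        filter_upwards [Lp.coeFn_smul c f] with x hx
        rw [hx, Pi.smul_apply, Pi.smul_apply, smul_eq_mul, smul_eq_mul]
        ring }
    C (fun f => by
      refine Lp.norm_le_mul_norm_of_ae_le_mul ?_
      filter_upwards [(memLp_mul hm hC f).coeFn_toLp] with x hx
      simp only [LinearMap.coe_mk, AddHom.coe_mk]
      rw [hx, norm_mul, Complex.norm_real]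
      exact mul_le_mul_of_nonneg_right (hC x) (norm_nonneg _))

theorem coeFn_mulOp {m : ℝ → ℝ} (hm : Measurable m) {C : ℝ} (hC : ∀ x, |m x| ≤ C) (f : L2) :
    ∀ᵐ x ∂halfLine, mulOp m hm C hC f x = m x * f x :=
  (memLp_mul hm hC f).coeFn_toLp

theorem abs_sqrt_le {u : ℝ → ℝ} {C : ℝ} (hC : ∀ x, u x ≤ C) (x : ℝ) : |√(u x)| ≤ √C := by
  rw [abs_of_nonneg (Real.sqrt_nonneg _)]
  exact Real.sqrt_le_sqrt (hC x)

/-- Multiplication by `√u`, for a measurable function `u` with values in `[1, C]`. -/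
def sqrtMulEquiv (u : ℝ → ℝ) (hu : Measurable u) (C : ℝ) (h1 : ∀ x, 1 ≤ u x)
    (hC : ∀ x, u x ≤ C) : L2 ≃L[ℂ] L2 :=
  have hne : ∀ x, ((√(u x) : ℝ) : ℂ) ≠ 0 := fun x => by
    have := Real.sqrt_pos.2 (zero_lt_one.trans_le (h1 x))
    exact_mod_cast this.ne'
  have hA := abs_sqrt_le hC
  have hB : ∀ x, |(√(u x))⁻¹| ≤ 1 := fun x => by
    rw [abs_of_nonneg (inv_nonneg.2 (Real.sqrt_nonneg _))]
    exact inv_le_one_of_one_le₀ (Real.one_le_sqrt.2 (h1 x))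
  ContinuousLinearEquiv.equivOfInverse (mulOp (fun x => √(u x)) hu.sqrt (√C) hA)
    (mulOp (fun x => (√(u x))⁻¹) hu.sqrt.inv 1 hB)
    (fun f => by
      refine Lp.ext ?_
      filter_upwards [coeFn_mulOp hu.sqrt hA f,
        coeFn_mulOp (m := fun x => (√(u x))⁻¹) hu.sqrt.inv hB (mulOp _ hu.sqrt _ hA f)]
        with x h2 h3
      rw [h3, h2, Complex.ofReal_inv, inv_mul_cancel_left₀ (hne x)])
    (fun f => by
      refine Lp.ext ?_
      filter_upwards [coeFn_mulOp (m := fun x => (√(u x))⁻¹) hu.sqrt.inv hB f,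
        coeFn_mulOp hu.sqrt hA (mulOp (fun x => (√(u x))⁻¹) hu.sqrt.inv _ hB f)]
        with x h2 h3
      rw [h3, h2, Complex.ofReal_inv, mul_inv_cancel_left₀ (hne x)])

theorem coeFn_sqrtMulEquiv {u : ℝ → ℝ} (hu : Measurable u) {C : ℝ} (h1 : ∀ x, 1 ≤ u x)
    (hC : ∀ x, u x ≤ C) (f : L2) :
    ∀ᵐ x ∂halfLine, sqrtMulEquiv u hu C h1 hC f x = (√(u x) : ℝ) * f x :=
  coeFn_mulOp hu.sqrt (abs_sqrt_le hC) f

theorem ae_norm_sq_sqrtMulEquiv {u : ℝ → ℝ} (hu : Measurable u) {C : ℝ} (h1 : ∀ x, 1 ≤ u x)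
    (hC : ∀ x, u x ≤ C) (f : L2) :
    ∀ᵐ x ∂halfLine, ‖sqrtMulEquiv u hu C h1 hC f x‖ ^ 2 = u x * ‖f x‖ ^ 2 := by
  filter_upwards [coeFn_sqrtMulEquiv hu h1 hC f] with x hx
  rw [hx, norm_mul, mul_pow, Complex.norm_real, Real.norm_eq_abs, sq_abs,
    Real.sq_sqrt (zero_le_one.trans (h1 x))]

theorem norm_sq_eq_integral (f : L2) : ‖f‖ ^ 2 = ∫ x, ‖f x‖ ^ 2 ∂halfLine := by
  rw [integral_eq_lintegral_of_nonneg_ae (.of_forall fun _ => by positivity)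
    ((Lp.memLp f).integrable_norm_pow two_ne_zero).aestronglyMeasurable]
  have h := congrArg ENNReal.toReal (enorm_sq_eq_lintegral f)
  rw [ENNReal.toReal_pow, toReal_enorm] at h
  rw [h]
  congr 2
  ext x
  rw [ENNReal.ofReal_pow (norm_nonneg _), ofReal_norm]

theorem norm_sq_le_of_ae_le {f₁ f₂ g₁ g₂ : L2} {c₁ c₂ d₁ d₂ : ℝ}
    (h : ∀ᵐ x ∂halfLine, c₁ * ‖f₁ x‖ ^ 2 + c₂ * ‖f₂ x‖ ^ 2 ≤
      d₁ * ‖g₁ x‖ ^ 2 + d₂ * ‖g₂ x‖ ^ 2) :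
    c₁ * ‖f₁‖ ^ 2 + c₂ * ‖f₂‖ ^ 2 ≤ d₁ * ‖g₁‖ ^ 2 + d₂ * ‖g₂‖ ^ 2 := by
  have hi : ∀ (c : ℝ) (f : L2), Integrable (fun x => c * ‖f x‖ ^ 2) halfLine := fun c f =>
    ((Lp.memLp f).integrable_norm_pow two_ne_zero).const_mul c
  simp only [norm_sq_eq_integral, ← integral_const_mul]
  rw [← integral_add (hi _ _) (hi _ _), ← integral_add (hi _ _) (hi _ _)]
  exact integral_mono_ae ((hi _ _).add (hi _ _)) ((hi _ _).add (hi _ _)) h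

/-! ### Similarity to a quasi-contraction semigroup for `J = ℤ₊` -/

theorem isC0Semigroup_conjBy {H : Type*} [NormedAddCommGroup H] [InnerProductSpace ℂ H]
    {T : ℝ → H →L[ℂ] H} (hT : IsC0Semigroup T) (R : H ≃L[ℂ] H) :
    IsC0Semigroup fun t => conjBy R (T t) where
  map_zero := by
    ext1 h
    simp [conjBy, hT.map_zero]
  map_add s t hs ht := by
    ext1 h
    simp [conjBy, hT.map_add s t hs ht]
  tendsto_zero h := by
    have h1 := (R.continuous.tendsto _).comp (hT.tendsto_zero (R.symm h))
    rw [R.apply_symm_apply] at h1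
    exact h1

/-- The diagonal operator `(f, g) ↦ (A f, B g)`. -/
def diagEquiv (A B : L2 ≃L[ℂ] L2) : L2Sum ≃L[ℂ] L2Sum :=
  ((WithLp.prodContinuousLinearEquiv 2 ℂ L2 L2).trans (A.prodCongr B)).trans
    (WithLp.prodContinuousLinearEquiv 2 ℂ L2 L2).symm

theorem norm_sq_diagEquiv_apply (A B : L2 ≃L[ℂ] L2) (h : L2Sum) :
    ‖diagEquiv A B h‖ ^ 2 = ‖A h.fst‖ ^ 2 + ‖B h.snd‖ ^ 2 :=
  WithLp.prod_norm_sq_eq_of_L2 _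

theorem norm_sq_add_le_two_mul (z w : ℂ) : ‖z + w‖ ^ 2 ≤ 2 * ‖z‖ ^ 2 + 2 * ‖w‖ ^ 2 := by
  have h1 : ‖z + w‖ ^ 2 ≤ (‖z‖ + ‖w‖) ^ 2 := pow_le_pow_left₀ (norm_nonneg _) (norm_add_le z w) 2
  nlinarith [sq_nonneg (‖z‖ - ‖w‖)]

section Positive

variable {a : ℤ → ℝ} (ha : IsLacunarySeq (Ici 0) a)

/-- Multiplication by the square root of the weight of the first component. -/
def leftWeight (a : ℤ → ℝ) {q : ℝ} (hq : 0 ≤ q) : L2 ≃L[ℂ] L2 :=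
  sqrtMulEquiv (weight a 1 q 1) (measurable_weight a 1 1 q) (1 + 1)
    (one_le_weight a 1 zero_le_one hq) (weight_le a 1 zero_le_one hq)

/-- Multiplication by the square root of the weight of the second component, translated by `t`. -/
def rightWeight (a : ℤ → ℝ) {q : ℝ} (hq : 0 ≤ q) (t : ℝ) : L2 ≃L[ℂ] L2 :=
  sqrtMulEquiv (fun y => weight a 4 q (-1) (y + t))
    ((measurable_weight a (-1) 4 q).comp (measurable_id.add_const t)) (1 + 4)
    (fun y => one_le_weight a (-1) (by norm_num) hq (y + t))
    (fun y => weight_le a (-1) (by norm_num) hq (y + t))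

/-- Weighting after the shift is the same as weighting with the translated weight before it, so the
cost of the right shift can be compared pointwise in the original variable. -/
theorem rightWeight_rightShift (a : ℤ → ℝ) {q : ℝ} (hq : 0 ≤ q) (t : ℝ) (g : L2) :
    rightWeight a hq 0 (rightShift t g) = rightShift t (rightWeight a hq t g) := by
  refine Lp.ext ?_
  have h1 : ∀ (s : ℝ) (f : L2), ∀ᵐ x ∂halfLine,
      rightWeight a hq s f x = (√(weight a 4 q (-1) (x + s)) : ℝ) * f x := fun s f =>
    coeFn_sqrtMulEquiv _ _ _ f
  filter_upwards [h1 0 (rightShift t g), ae_shift (-t) (h1 t g), coeFn_shift (-t) g,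
    coeFn_shift (-t) (rightWeight a hq t g)] with x h2 h3 h4 h5
  rw [h2]
  simp only [rightShift]
  rcases le_or_gt 0 (x + -t) with h6 | h6
  · rw [h4.1 h6, h5.1 h6, h3 h6, neg_add_cancel_right, add_zero]
  · rw [h4.2 h6, h5.2 h6, mul_zero]

include ha

/-- The weight is at most $2$, so an added copy costs at most $4|V(t)g|^2$. The doubled left-shifted
part is covered by `two_mul_weight_le` where copies land; elsewhere the weight changes at most by
the factor `E`. -/
theorem norm_sq_leftWeight_add_le {q t E : ℝ} (hq : q * a 0 = 1) (hq0 : 0 ≤ q) (ht : 0 < t)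
    (hE : 1 + 8 * (q * t) ≤ E) (f g : L2) :
    ‖leftWeight a hq0 (leftShift t f + V (Ici 0) a ha t g)‖ ^ 2 ≤
      E * ‖leftWeight a hq0 f‖ ^ 2 + 4 * ‖V (Ici 0) a ha t g‖ ^ 2 := by
  have hE0 : 0 ≤ E := le_trans (by positivity) hE
  have h1 : ‖shift t (leftWeight a hq0 f)‖ ^ 2 ≤ ‖leftWeight a hq0 f‖ ^ 2 :=
    pow_le_pow_left₀ (norm_nonneg _) (norm_shift_apply_le t _) 2
  refine le_trans ?_ (add_le_add_left (mul_le_mul_of_nonneg_left h1 hE0) _)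
  have hA : ∀ f : L2, ∀ᵐ x ∂halfLine, ‖leftWeight a hq0 f x‖ ^ 2 = weight a 1 q 1 x * ‖f x‖ ^ 2 :=
    ae_norm_sq_sqrtMulEquiv _ _ _
  have key := norm_sq_le_of_ae_le (c₁ := 1) (c₂ := 0) (d₁ := E) (d₂ := 4)
    (f₁ := leftWeight a hq0 (leftShift t f + V (Ici 0) a ha t g)) (f₂ := 0)
    (g₁ := shift t (leftWeight a hq0 f)) (g₂ := V (Ici 0) a ha t g) ?_
  · linarith
  filter_upwards [hA (leftShift t f + V (Ici 0) a ha t g), Lp.coeFn_add (leftShift t f)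
    (V (Ici 0) a ha t g), coeFn_shift t f, coeFn_shift t (leftWeight a hq0 f), ae_shift t (hA f),
    coeFn_V ha ht g, ae_nonneg_halfLine] with x h2 h3 h4 h5 h6 h7 hx
  have hxt : 0 ≤ x + t := by linarith
  rw [zero_mul, add_zero, one_mul, h2, h3, Pi.add_apply, leftShift, h4.1 hxt, h5.1 hxt, h6 hxt]
  by_cases hI : ∃ n, x ∈ I (Ici 0) a t n
  · obtain ⟨n, hn⟩ := hI
    obtain ⟨hn0, -, hn1, hn2, -⟩ := (ha.mem_I_iff ht).1 hn
    lift n to ℕ using hn0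
    have h8 := two_mul_weight_le ha hq hq0 hE n hn2 (by linarith)
    have h9 := weight_le a 1 zero_le_one hq0 x
    have h10 := one_le_weight a 1 zero_le_one hq0 x
    have h11 := mul_le_mul_of_nonneg_left
      (norm_sq_add_le_two_mul (f (x + t)) (V (Ici 0) a ha t g x)) (zero_le_one.trans h10)
    have h12 := mul_le_mul_of_nonneg_right h8 (sq_nonneg ‖f (x + t)‖)
    have h13 := mul_le_mul_of_nonneg_right h9 (sq_nonneg ‖V (Ici 0) a ha t g x‖)
    linarith
  · rw [h7.2 (not_exists.1 hI), add_zero, norm_zero]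
    have h8 := weight_le_mul a (x := x) (z := x + t) (σ := 1) (c := 1) (E := E) zero_le_one hq0
      ht.le (by linarith [mul_nonneg hq0 ht.le]) (fun p => by ring)
    have h9 := mul_le_mul_of_nonneg_right h8 (sq_nonneg ‖f (x + t)‖)
    linarith

/-- Supplies the $4\|V(t)g\|^2$ owed by the first component: only mass in the intervals
$[a_n-t,a_n)$ emits, and there the weight drops by the required $4$. -/
theorem norm_sq_rightWeight_add_le {q t E : ℝ} (hq : q * a 0 = 1) (hq0 : 0 ≤ q) (ht : 0 < t)
    (hE : 1 + 8 * (q * t) ≤ E) (g : L2) :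
    4 * ‖V (Ici 0) a ha t g‖ ^ 2 + ‖rightWeight a hq0 t g‖ ^ 2 ≤
      E * ‖rightWeight a hq0 0 g‖ ^ 2 := by
  set S : Set ℝ := ⋃ n : ℕ, Ico (a n - t) (a n) with hS
  have hSm : MeasurableSet S := MeasurableSet.iUnion fun _ => measurableSet_Ico
  have hg : MemLp (S.indicator g) 2 halfLine := (Lp.memLp g).indicator hSm
  have hV : V (Ici 0) a ha t g = V (Ici 0) a ha t (hg.toLp _) := by
    refine V_congr ha ?_
    filter_upwards [hg.coeFn_toLp] with y hy _
    rintro ⟨n, hn, h1, h2⟩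
    lift n to ℕ using hn
    rw [hy, indicator_of_mem (show y ∈ S from mem_iUnion.2 ⟨n, h1, h2⟩)]
  have h1 : ‖V (Ici 0) a ha t g‖ ^ 2 ≤ ‖hg.toLp _‖ ^ 2 := by
    rw [hV]
    exact pow_le_pow_left₀ (norm_nonneg _) (norm_V_apply_le ha t _) 2
  have hB : ∀ s, ∀ᵐ y ∂halfLine,
      ‖rightWeight a hq0 s g y‖ ^ 2 = weight a 4 q (-1) (y + s) * ‖g y‖ ^ 2 := fun s =>
    ae_norm_sq_sqrtMulEquiv _ _ _ _
  have key := norm_sq_le_of_ae_le (c₁ := 4) (c₂ := 1) (d₁ := E) (d₂ := 0)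
    (f₁ := hg.toLp _) (f₂ := rightWeight a hq0 t g) (g₁ := rightWeight a hq0 0 g) (g₂ := 0) ?_
  · linarith
  filter_upwards [hg.coeFn_toLp, hB t, hB 0] with y h2 h3 h4
  rw [h2, h3, h4, zero_mul, add_zero, one_mul, add_zero]
  by_cases hy : y ∈ S
  · rw [indicator_of_mem hy]
    obtain ⟨n, h5, h6⟩ := mem_iUnion.1 hy
    have h7 := mul_le_mul_of_nonneg_right (weight_add_four_le ha hq hq0 hE n h6 h5)
      (sq_nonneg ‖g y‖)
    linarith
  · rw [indicator_of_notMem hy, norm_zero]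
    have h8 := weight_le_mul a (x := y + t) (z := y) (σ := -1) (c := 4) (E := E) (by norm_num) hq0
      ht.le (by linarith [mul_nonneg hq0 ht.le]) (fun p => by ring)
    have h9 := mul_le_mul_of_nonneg_right h8 (sq_nonneg ‖g y‖)
    linarith

theorem isSQC_of_Ici : IsSQC (T (Ici 0) a ha) := by
  have ha0 : 0 < a 0 := ha.pos 0 (by simp)
  have hq0 : 0 ≤ (a 0)⁻¹ := (inv_pos.2 ha0).le
  have hq : (a 0)⁻¹ * a 0 = 1 := inv_mul_cancel₀ ha0.ne'
  -- With $q=1/a_0$, the squared norm may grow by $1+8qt\le e^{8qt}$, which gives the rate $4/a_0$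
  -- for the norm.
  refine ⟨isC0Semigroup_T ha, diagEquiv (leftWeight a hq0) (rightWeight a hq0 0),
    isC0Semigroup_conjBy (isC0Semigroup_T ha) _, 4 * (a 0)⁻¹, fun t ht => ?_⟩
  set R := diagEquiv (leftWeight a hq0) (rightWeight a hq0 0) with hR
  have key : ∀ h, ‖R (T (Ici 0) a ha t h)‖ ≤ Real.exp (4 * (a 0)⁻¹ * t) * ‖R h‖ := by
    intro h
    rcases ht.eq_or_lt with rfl | ht
    · rw [(isC0Semigroup_T ha).map_zero, mul_zero, Real.exp_zero, one_mul]
      exact le_rfl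
    have hE : 1 + 8 * ((a 0)⁻¹ * t) ≤ Real.exp (4 * (a 0)⁻¹ * t) ^ 2 := by
      rw [← Real.exp_nat_mul]
      have := Real.add_one_le_exp (((2 : ℕ) : ℝ) * (4 * (a 0)⁻¹ * t))
      push_cast at this ⊢
      linarith
    refine abs_le_of_sq_le_sq' ?_ (by positivity) |>.2
    rw [mul_pow, norm_sq_diagEquiv_apply, norm_sq_diagEquiv_apply, T_apply]
    have h1 := norm_sq_leftWeight_add_le ha hq hq0 ht hE h.fst h.snd
    have h2 := norm_sq_rightWeight_add_le ha hq hq0 ht hE h.snd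
    have h3 : ‖rightWeight a hq0 0 (rightShift t h.snd)‖ ^ 2 ≤ ‖rightWeight a hq0 t h.snd‖ ^ 2 := by
      rw [rightWeight_rightShift]
      exact pow_le_pow_left₀ (norm_nonneg _) (norm_shift_apply_le (-t) _) 2
    simp only [WithLp.toLp_fst, WithLp.toLp_snd]
    linarith
  refine ContinuousLinearMap.opNorm_le_bound _ (Real.exp_pos _).le fun x => ?_
  have h1 := key (R.symm x)
  rwa [R.apply_symm_apply] at h1

end Positive

end PackelSemigroup

end

theorem mainTheorem11 (J : Set ℤ) (a : ℤ → ℝ) (ha : PackelSemigroup.IsLacunarySeq J a) :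
    PackelSemigroup.IsC0Semigroup (PackelSemigroup.T J a ha) ∧
    (∀ t : ℝ, 0 < t →
      (PackelSemigroup.IsSimilarToContraction (PackelSemigroup.T J a ha t) ↔ J = Set.Iic 0)) ∧
    (PackelSemigroup.IsSQC (PackelSemigroup.T J a ha) ↔ J = Set.Ici 0) := by
  refine ⟨PackelSemigroup.isC0Semigroup_T ha, fun t ht => ⟨fun h => ?_, ?_⟩, fun h => ?_, ?_⟩
  · by_contra hJ
    refine PackelSemigroup.not_isSimilarToContraction ha (fun n hn => ?_) ht h
    rcases ha.index with rfl | rfl | rfl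
    · trivial
    · exact hn
    · exact absurd rfl hJ
  · rintro rfl
    exact PackelSemigroup.isSimilarToContraction_of_Iic ha ht
  · by_contra hJ
    refine PackelSemigroup.not_isSQC ha (fun n hn => ?_) h
    rcases ha.index with rfl | rfl | rfl
    · trivial
    · exact absurd rfl hJ
    · exact hn
  · rintro rfl
    exact PackelSemigroup.isSQC_of_Ici ha
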